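/- Let $X=(X_t)_{t\ge 0}$ with probability measures $(\mathbf P_x)_{x\in\mathbb R^d}$, $\mathbf P_x(X_0=x)=1$, be a multidimensional diffusion, that is, a homogeneous nonterminating strong Markov process with values in $\mathbb R^d$, continuous paths and the Feller property. Let $\mathbb F=(\mathcal F_t)_{t\ge0}$ be its completed natural filtration: $\mathcal F_t=\bigcap_\nu \mathcal F_t^\nu$, where $\nu$ runs over the probability measures on $\mathbb R^d$, $\mathbf P_\nu=\int \mathbf P_x\,\nu(dx)$, and $\mathcal F_t^\nu$ is generated by $\sigma(X_s:s\le t)$ and the negligible sets of the $\mathbf P_\nu$-completion of $\sigma(X_s:s\ge0)$; the strong Markov property is understood with respect to $\mathbb F$. Let $r>0$, let $g\colon\mathbb R^d\to[0,\infty)$ be continuous, and consider the problem $$V(x)=\sup_\tau \mathbf E_x\big(e^{-r\tau}g(X_\tau)\big),\qquad x\in\mathbb R^d,$$ where $\tau$ runs over all $[0,\infty]$-valued stopping times of $\mathbb F$, and $e^{-r\tau}g(X_\tau):=\limsup_{t\to\infty}e^{-rt}g(X_t)$ on $\{\tau=\infty\}$. A stopping time is called optimal if it attains this supremum for every $x$.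 Let $G_r(x,H)=\int_0^\infty e^{-rt}\,\mathbf P_x(X_t\in H)\,dt$ be the $r$-Green measure. Assume that there is a Borel function $f\colon\mathbb R^d\to\mathbb R$, integrable with respect to $G_r(x,\cdot)$ for every $x$, such that $$g(x)=\int_{\mathbb R^d}f(y)\,G_r(x,dy)\quad\text{for all }x\in\mathbb R^d.$$ Let $S\subseteq\mathbb R^d$ be a Borel set with $f\ge0$ on $S$, put $\widetilde V(x)=\int_S f(y)\,G_r(x,dy)$, and assume that (a) $\widetilde V(x)\ge g(x)$ for all $x\in\mathbb R^d\setminus S$; (b) $\widetilde V(x)=g(x)$ for all $x\in\partial S$ or, equivalently, $\int_{S^c}f(y)\,G_r(x,dy)=0$ for all $x\in\partial S$. Then the hitting time $h_S=\inf\{t\ge0: X_t\in S\}$ (with $\inf\emptyset=\infty$) is an optimal stopping time, and $\widetilde V(x)=V(x)$ for all $x\in\mathbb R^d$. -/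

import Mathlib

open MeasureTheory ProbabilityTheory Filter Topology Set
open scoped NNReal ENNReal ZeroAtInfty

namespace GreenStopping

section
variable {Ω E : Type*} [mE : MeasurableSpace E]

/-- `𝓕_t^0 = σ(X_s, s ≤ t)`. -/
@[reducible] def pastSigma (X : ℝ≥0 → Ω → E) (t : ℝ≥0) : MeasurableSpace Ω :=
  ⨆ s, ⨆ (_ : s ≤ t), MeasurableSpace.comap (X s) mE

/-- `𝓕_∞^0 = σ(X_s, s ≥ 0)`. -/
@[reducible] def processSigma (X : ℝ≥0 → Ω → E) : MeasurableSpace Ω :=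
  ⨆ s, MeasurableSpace.comap (X s) mE

theorem pastSigma_mono (X : ℝ≥0 → Ω → E) : Monotone (pastSigma X) := fun _ _ hst =>
  iSup_mono fun _ => iSup_mono' fun h => ⟨h.trans hst, le_rfl⟩

theorem pastSigma_le (X : ℝ≥0 → Ω → E) (t : ℝ≥0) : pastSigma X t ≤ processSigma X :=
  iSup_mono fun _ => iSup_le fun _ => le_rfl

variable [mΩ : MeasurableSpace Ω]

/-- For a probability measure `ν` on the state space let `P_ν = ∫ P_x ν(dx)`. A set `A` belongs
to `augment X P 𝓖` when for every `ν` it belongs to the `σ`-field generated by `𝓖` and the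
`P_ν`-negligible sets of the `P_ν`-completion of `𝓕_∞^0`, that is, when it differs from a set
of `𝓖` by a subset of a `P_ν`-null set of `𝓕_∞^0`. -/
@[reducible] def augment (X : ℝ≥0 → Ω → E) (P : Kernel E Ω) (𝓖 : MeasurableSpace Ω) :
    MeasurableSpace Ω where
  MeasurableSet' A := ∀ ν : Measure E, IsProbabilityMeasure ν → ∃ B N : Set Ω,
    MeasurableSet[𝓖] B ∧ MeasurableSet[processSigma X] N ∧ (ν.bind P) N = 0 ∧ symmDiff A B ⊆ N
  measurableSet_empty := fun ν _ => ⟨∅, ∅, @MeasurableSet.empty _ 𝓖,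
    @MeasurableSet.empty _ (processSigma X), measure_empty, by simp⟩
  measurableSet_compl := by
    intro A hA ν hν
    obtain ⟨B, N, hB, hN, hN0, hAB⟩ := hA ν hν
    refine ⟨Bᶜ, N, hB.compl, hN, hN0, ?_⟩
    intro ω hω
    apply hAB
    simp only [mem_symmDiff, mem_compl_iff] at hω ⊢
    tauto
  measurableSet_iUnion := by
    intro A hA ν hν
    choose B N hB hN hN0 hAB using fun i => hA i ν hν
    refine ⟨⋃ i, B i, ⋃ i, N i, MeasurableSet.iUnion hB, MeasurableSet.iUnion hN,
      measure_iUnion_null hN0, ?_⟩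
    intro ω hω
    simp only [mem_symmDiff, mem_iUnion, not_exists] at hω ⊢
    rcases hω with ⟨⟨i, hi⟩, h⟩ | ⟨⟨i, hi⟩, h⟩
    · exact ⟨i, hAB i (Or.inl ⟨hi, h i⟩)⟩
    · exact ⟨i, hAB i (Or.inr ⟨hi, h i⟩)⟩

theorem augment_mono (X : ℝ≥0 → Ω → E) (P : Kernel E Ω) : Monotone (augment X P) := by
  intro 𝓖 𝓗 h A hA ν hν
  obtain ⟨B, N, hB, hN⟩ := hA ν hν
  exact ⟨B, N, h _ hB, hN⟩

/-- The completed filtration `𝔽 = (𝓕_t)` of the process: `𝓕_t = ⋂_ν 𝓕_t^ν`, where `𝓕_t^ν` is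
generated by `𝓕_t^0` and the `P_ν`-negligible sets. -/
def completedFiltration (X : ℝ≥0 → Ω → E) (P : Kernel E Ω) :
    Filtration ℝ≥0 (augment X P (processSigma X)) where
  seq t := augment X P (pastSigma X t)
  mono' := fun _ _ h => augment_mono X P (pastSigma_mono X h)
  le' := fun t => augment_mono X P (pastSigma_le X t)

/-- `(X, (P_x)_x)` is a diffusion: a homogeneous nonterminating Markov process (each `P_x`
will be a probability measure) with continuous paths, the Feller property, and the strong Markov
property with respect to its completed filtration. -/
structure IsDiffusion [TopologicalSpace E] (X : ℝ≥0 → Ω → E) (P : Kernel E Ω) : Prop where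
  measurable : ∀ t, Measurable (X t)
  continuous_paths : ∀ ω, Continuous fun t => X t ω
  initial : ∀ x, ∀ᵐ ω ∂(P x), X 0 ω = x
  /-- The transition operators `P_t φ(x) = E_x φ(X_t)` map `C₀` into `C₀`. -/
  feller : ∀ (t : ℝ≥0) (φ : C₀(E, ℝ)), ∃ ψ : C₀(E, ℝ), ∀ x, ψ x = ∫ ω, φ (X t ω) ∂(P x)
  /-- `P_t φ(x) → φ(x)` as `t ↓ 0`, for `φ` in `C₀`. -/
  feller_zero : ∀ (φ : C₀(E, ℝ)) (x : E),
    Tendsto (fun t : ℝ≥0 => ∫ ω, φ (X t ω) ∂(P x)) (𝓝 0) (𝓝 (φ x))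
  /-- `P_x(X_{τ+s} ∈ B | 𝓕_τ) = P_{X_τ}(X_s ∈ B)` on `{τ < ∞}`, tested on the sets
  `A ∈ 𝓕_τ`. -/
  strong_markov : ∀ (τ : Ω → WithTop ℝ≥0) (hτ : IsStoppingTime (completedFiltration X P) τ)
    (A : Set Ω), MeasurableSet[hτ.measurableSpace] A →
    ∀ (s : ℝ≥0) (B : Set E), MeasurableSet B → ∀ x : E,
      P x (A ∩ {ω | τ ω ≠ ⊤ ∧ X ((τ ω).untopD 0 + s) ω ∈ B}) =
        ∫⁻ ω in A ∩ {ω | τ ω ≠ ⊤}, P (X ((τ ω).untopD 0) ω) {ω' | X s ω' ∈ B} ∂(P x)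

/-- The `r`-Green measure `G_r(x, ·) = ∫_0^∞ e^{-rt} P_x(X_t ∈ ·) dt`. -/
noncomputable def greenMeasure (X : ℝ≥0 → Ω → E) (P : Kernel E Ω) (r : ℝ) (x : E) : Measure E :=
  ((volume.restrict (Ici (0 : ℝ))).withDensity fun t => ENNReal.ofReal (Real.exp (-(r * t)))).bind
    fun t => (P x).map (X t.toNNReal)

/-- The discounted reward `e^{-rt} g(X_t(ω))` at time `t ∈ [0, ∞]`, which for `t = ∞` is
`limsup_{s → ∞} e^{-rs} g(X_s(ω))`. -/
noncomputable def discountedReward (X : ℝ≥0 → Ω → E) (r : ℝ) (g : E → ℝ) (ω : Ω) :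
    WithTop ℝ≥0 → ℝ≥0∞
  | ⊤ => limsup (fun s : ℝ≥0 => ENNReal.ofReal (Real.exp (-(r * s)) * g (X s ω))) atTop
  | (t : ℝ≥0) => ENNReal.ofReal (Real.exp (-(r * t)) * g (X t ω))

/-- `E_x(e^{-rτ} g(X_τ))`. -/
noncomputable def expectedReward (X : ℝ≥0 → Ω → E) (P : Kernel E Ω) (r : ℝ) (g : E → ℝ)
    (τ : Ω → WithTop ℝ≥0) (x : E) : ℝ≥0∞ :=
  ∫⁻ ω, discountedReward X r g ω (τ ω) ∂(P x)

/-- The value function `V(x) = sup_τ E_x(e^{-rτ} g(X_τ))`, the supremum being over all stopping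
times of the completed filtration. -/
noncomputable def valueFunction (X : ℝ≥0 → Ω → E) (P : Kernel E Ω) (r : ℝ) (g : E → ℝ)
    (x : E) : ℝ≥0∞ :=
  ⨆ (τ : Ω → WithTop ℝ≥0) (_ : IsStoppingTime (completedFiltration X P) τ),
    expectedReward X P r g τ x

/-- `τ` is a stopping time that attains the supremum for every starting point. -/
def IsOptimal (X : ℝ≥0 → Ω → E) (P : Kernel E Ω) (r : ℝ) (g : E → ℝ)
    (τ : Ω → WithTop ℝ≥0) : Prop :=
  IsStoppingTime (completedFiltration X P) τ ∧
    ∀ x, expectedReward X P r g τ x = valueFunction X P r g x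

/-- The hitting time `h_S = inf {t ≥ 0 : X_t ∈ S}`, equal to `∞` if `S` is never hit. -/
noncomputable def hitTime (X : ℝ≥0 → Ω → E) (S : Set E) : Ω → WithTop ℝ≥0 :=
  hittingAfter X S 0

/-- The defining formula of the Green measure, on Borel sets. -/
theorem greenMeasure_apply [TopologicalSpace E] [TopologicalSpace.PseudoMetrizableSpace E]
    [BorelSpace E]
    {X : ℝ≥0 → Ω → E} {P : Kernel E Ω} [IsMarkovKernel P] (hX : IsDiffusion X P) (r : ℝ) (x : E)
    {H : Set E} (hH : MeasurableSet H) :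
    greenMeasure X P r x H =
      ∫⁻ t in Ici (0 : ℝ), ENNReal.ofReal (Real.exp (-(r * t))) * P x {ω | X t.toNNReal ω ∈ H} := by
  have hu : Measurable (Function.uncurry X) :=
    measurable_uncurry_of_continuous_of_measurable hX.continuous_paths hX.measurable
  have hm : ∀ H : Set E, MeasurableSet H →
      Measurable fun t : ℝ => P x {ω | X t.toNNReal ω ∈ H} := fun H hH =>
    (measurable_measure_prodMk_left (ν := P x) (hu hH)).comp measurable_real_toNNReal
  have hk : Measurable fun t : ℝ => (P x).map (X t.toNNReal) := by
    refine Measure.measurable_of_measurable_coe _ fun H hH => ?_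
    simp_rw [Measure.map_apply (hX.measurable _) hH]
    exact hm H hH
  rw [greenMeasure, Measure.bind_apply hH hk.aemeasurable,
    lintegral_withDensity_eq_lintegral_mul _ (by fun_prop)]
  · refine lintegral_congr fun t => ?_
    simp only [Pi.mul_apply]
    rw [Measure.map_apply (hX.measurable _) hH]
    rfl
  · simp_rw [Measure.map_apply (hX.measurable _) hH]
    exact hm H hH

end

end GreenStopping

/-! For `u ≥ 0` let `U(x) = ∫ u dG_r(x, ·)`. The strong Markov property gives `E_x[e^{-rτ} U(X_τ); τ
< ∞] = E_x ∫_τ^∞ e^{-rt} u(X_t) dt` (`lintegral_greenMeasure_stoppingTime`). Hence the left side is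
at most `U(x)` for every stopping time `τ`, with equality when `u` vanishes along the path before
`τ`.

Take `u = f 1_S`, whose potential is `Ṽ`. If `Ṽ ≥ g` everywhere, then `Ṽ` bounds the reward of every
stopping time. If also `Ṽ = g` on `closure S`, then `h_S` attains the bound, because `X` avoids `S`
before `h_S` and lies in `closure S` at `h_S`. This is `isOptimal_hitTime`. What is missing from (a)
and (b) is `Ṽ = g` on `interior S`. There `g - Ṽ` is the potential of `f 1_{Sᶜ}`, a charge not
visited before the exit from the interior; the exit is through the boundary, where this potential is
zero (`integral_greenMeasure_eq_zero_of_frontier`). The reward at `τ = ∞` is zero almost surely by a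
maximal inequality for potentials (`ae_limsup_eq_zero`).

That `h_S` is a stopping time for a Borel set `S` needs two facts. Events of hitting by a fixed time
are preimages of analytic sets, and these are universally measurable. The completed filtration is
right-continuous: by the Feller property, a measure reweighted by an event of the immediate future
of `t` is still Markov from `t` on, so it is determined by its values on the past at `t`. -/

namespace GreenStopping

/-! ### Universal measurability of analytic sets. -/

/-- A box of sequences is compact. -/
theorem isCompact_box (n : ℕ → ℕ) : IsCompact {x : ℕ → ℕ | ∀ i, x i ≤ n i} := by
  have : {x : ℕ → ℕ | ∀ i, x i ≤ n i} = Set.pi univ fun i => Iic (n i) := by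
    ext; simp [Pi.le_def]
  rw [this]
  exact isCompact_univ_pi fun i => (Set.finite_Iic (n i)).isCompact

/-- A neighbourhood of a box of sequences contains all sequences obeying finitely many of the
bounds that define the box. -/
theorem exists_prefix_box_subset {V : Set (ℕ → ℕ)} (hV : IsOpen V) (n : ℕ → ℕ)
    (h : {x : ℕ → ℕ | ∀ i, x i ≤ n i} ⊆ V) : ∃ k, {x : ℕ → ℕ | ∀ i < k, x i ≤ n i} ⊆ V := by
  by_contra! hcon
  simp only [Set.not_subset] at hcon
  choose x hx hxV using hcon
  have hK := isCompact_box n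
  -- Truncation moves the points into the compact box. Coordinate `i` of the `k`-th point is
  -- unchanged once `k > i`, so the truncated and the original points have the same limits.
  obtain ⟨y, hy, φ, hφ, hlim⟩ := hK.tendsto_subseq (x := fun k i => min (x k i) (n i))
    fun k i => min_le_right _ _
  have hlim' : Tendsto (x ∘ φ) atTop (𝓝 y) := by
    rw [tendsto_pi_nhds] at hlim ⊢
    intro i
    refine (hlim i).congr' ?_
    filter_upwards [eventually_gt_atTop i] with k hk
    exact min_eq_left (hx (φ k) i (hk.trans_le (hφ.id_le k)))
  exact hV.isClosed_compl.mem_of_tendsto hlim' (Eventually.of_forall fun k => hxV (φ k)) (h hy)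

/-- Inner regularity of the outer measure of a continuous image of the Baire space. -/
theorem exists_isCompact_subset_range_le_measure {α : Type*} [TopologicalSpace α]
    [TopologicalSpace.PseudoMetrizableSpace α] [MeasurableSpace α] [BorelSpace α] (μ : Measure α)
    [IsFiniteMeasure μ] {f : (ℕ → ℕ) → α} (hf : Continuous f) {c : ℝ≥0∞} (hc : c < μ (range f)) :
    ∃ K ⊆ range f, IsCompact K ∧ c ≤ μ K := by
  -- Coordinates are bounded one at a time. Continuity from below, valid for outer measures of
  -- arbitrary increasing sets, keeps the strict inequality.
  have step : ∀ (T : Set (ℕ → ℕ)) (k : ℕ), c < μ (f '' T) →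
      ∃ m, c < μ (f '' (T ∩ {x | x k ≤ m})) := by
    intro T k hT
    have hU : f '' T = ⋃ m, f '' (T ∩ {x | x k ≤ m}) := by
      rw [← image_iUnion, ← inter_iUnion]
      congr 1
      symm
      rw [inter_eq_left]
      intro x _
      exact mem_iUnion.2 ⟨x k, le_refl (x k)⟩
    have hmono : Monotone fun m => f '' (T ∩ {x | x k ≤ m}) := fun a b hab =>
      image_mono (inter_subset_inter_right _ fun x hx => le_trans hx hab)
    rw [hU, hmono.measure_iUnion] at hT
    exact lt_iSup_iff.1 hT
  choose m hm using step
  let T : ℕ → {T : Set (ℕ → ℕ) // c < μ (f '' T)} := fun k =>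
    Nat.rec ⟨univ, by rwa [image_univ]⟩ (fun k T => ⟨_, hm T.1 k T.2⟩) k
  let n : ℕ → ℕ := fun k => m (T k).1 k (T k).2
  have hT : ∀ k, (T k).1 = {x : ℕ → ℕ | ∀ i < k, x i ≤ n i} := by
    intro k
    induction k with
    | zero => ext; simp [T]
    | succ k ih =>
      change (T k).1 ∩ {x | x k ≤ n k} = _
      rw [ih]
      ext x
      simp only [mem_inter_iff, mem_ofPred_eq, Nat.lt_succ_iff_lt_or_eq, or_imp, forall_and,
        forall_eq]
  have hK0 := isCompact_box n
  refine ⟨f '' {x | ∀ i, x i ≤ n i}, image_subset_range _ _, hK0.image hf, ?_⟩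
  -- By outer regularity it suffices to bound open `U` from below; such a `U` already contains the
  -- image of some `T k`, of measure above `c`.
  rw [Set.measure_eq_iInf_isOpen]
  refine le_iInf₂ fun U hU => le_iInf fun hUo => ?_
  obtain ⟨k, hk⟩ := exists_prefix_box_subset (hUo.preimage hf) n (image_subset_iff.1 hU)
  rw [← hT] at hk
  exact (T k).2.le.trans (measure_mono (image_subset_iff.2 hk))

/-- Analytic sets are universally measurable. -/
theorem nullMeasurableSet_of_analyticSet {α : Type*} [TopologicalSpace α]
    [TopologicalSpace.MetrizableSpace α] [MeasurableSpace α] [BorelSpace α] (μ : Measure α)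
    [IsFiniteMeasure μ] {s : Set α} (hs : AnalyticSet s) : NullMeasurableSet s μ := by
  rw [AnalyticSet] at hs
  rcases hs with rfl | ⟨f, hf, rfl⟩
  · exact MeasurableSet.empty.nullMeasurableSet
  rcases eq_or_ne (μ (range f)) 0 with h0 | h0
  · exact NullMeasurableSet.of_null h0
  obtain ⟨u, -, hu, hulim⟩ := exists_seq_strictMono_tendsto' (pos_iff_ne_zero.2 h0)
  choose K hKs hK hle using fun k => exists_isCompact_subset_range_le_measure μ hf (hu k).2
  have hKm : MeasurableSet (⋃ k, K k) := MeasurableSet.iUnion fun k => (hK k).isClosed.measurableSet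
  have hsub : (⋃ k, K k) ⊆ range f := iUnion_subset hKs
  have hge : μ (range f) ≤ μ (⋃ k, K k) :=
    le_of_tendsto' hulim fun k => (hle k).trans (measure_mono (subset_iUnion K k))
  -- The range lies between a `σ`-compact set and its measurable hull, and these have the same
  -- finite measure.
  have h1 : (⋃ k, K k) =ᵐ[μ] toMeasurable μ (range f) :=
    ae_eq_of_subset_of_measure_ge (hsub.trans (subset_toMeasurable _ _))
      (by rwa [measure_toMeasurable]) hKm.nullMeasurableSet (measure_ne_top _ _)
  refine hKm.nullMeasurableSet.congr ?_
  exact (LE.le.eventuallyLE hsub).antisymm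
    ((LE.le.eventuallyLE (subset_toMeasurable μ (range f))).trans h1.symm.le)

/-! ### Events of the augmented past obtained by projection. -/

section
variable {Ω E : Type*} [mE : MeasurableSpace E]

theorem measurable_pastSigma (X : ℝ≥0 → Ω → E) {s t : ℝ≥0} (h : s ≤ t) :
    Measurable[pastSigma X t] (X s) := by
  rw [measurable_iff_comap_le]
  exact le_iSup₂_of_le s h le_rfl

theorem processSigma_le [mΩ : MeasurableSpace Ω] {X : ℝ≥0 → Ω → E} (hX : ∀ t, Measurable (X t)) : processSigma X ≤ mΩ :=
  iSup_le fun t => (hX t).comap_le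

/-- The preimage of an analytic set under a `𝓖`-measurable map lies in the augmentation of `𝓖`. -/
theorem measurableSet_augment_preimage {𝓖 : MeasurableSpace Ω} [mΩ : MeasurableSpace Ω]
    {X : ℝ≥0 → Ω → E} (hX : ∀ t, Measurable (X t))
    (P : Kernel E Ω) [IsMarkovKernel P] (h𝓖 : 𝓖 ≤ processSigma X)
    {Z : Type*} [TopologicalSpace Z] [TopologicalSpace.MetrizableSpace Z] [MeasurableSpace Z]
    [BorelSpace Z] {Y : Ω → Z} (hY : Measurable[𝓖] Y) {A : Set Z} (hA : AnalyticSet A) :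
    MeasurableSet[augment X P 𝓖] (Y ⁻¹' A) := by
  intro ν hν
  have hY' : Measurable Y := hY.mono (h𝓖.trans (processSigma_le hX)) le_rfl
  -- `B` may depend on `ν`, as the definition of `augment` allows.
  obtain ⟨B, -, hB, hBA⟩ :=
    (nullMeasurableSet_of_analyticSet ((ν.bind P).map Y) hA).exists_measurable_superset_ae_eq
  have h0 : (ν.bind P).map Y (symmDiff A B) = 0 := by
    rw [measure_symmDiff_eq_zero_iff]
    exact hBA.symm
  obtain ⟨N, hN, hNm, hN0⟩ := exists_measurable_superset_of_null h0
  refine ⟨Y ⁻¹' B, Y ⁻¹' N, hY hB, h𝓖 _ (hY hNm), ?_, fun ω hω => hN hω⟩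
  rwa [Measure.map_apply hY' hNm] at hN0

end

/-- The times `q n` form a dense sequence in `[0, b]`. -/
theorem exists_dense_seq_Iic (b : ℝ≥0) :
    ∃ q : ℕ → ℝ≥0, (∀ n, q n ≤ b) ∧ ∀ s ≤ b, (comap q (𝓝 s)).NeBot := by
  have : Nonempty (Iic b) := ⟨⟨0, mem_Iic.2 zero_le⟩⟩
  refine ⟨fun n => TopologicalSpace.denseSeq (Iic b) n,
    fun n => (TopologicalSpace.denseSeq (Iic b) n).2, fun s hs => ?_⟩
  rw [comap_neBot_iff]
  intro t ht
  have h2 := (TopologicalSpace.denseRange_denseSeq (Iic b)).mem_nhds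
    (x := ⟨s, hs⟩) (continuous_subtype_val.continuousAt.preimage_mem_nhds ht)
  exact h2

section
variable {Ω E : Type*} [MetricSpace E] [ProperSpace E] [MeasurableSpace E] [BorelSpace E]

/-- By path continuity `X s` is the limit of the values `X (q n)` along `comap q (𝓝 s)`. The
relation is Borel because it can be tested with countably many radii and the indices `n`. -/
theorem measurableSet_tendsto_comap (q : ℕ → ℝ≥0) :
    MeasurableSet {p : (ℝ≥0 × E) × (ℕ → E) | Tendsto p.2 (comap q (𝓝 p.1.1)) (𝓝 p.1.2)} := by
  have h : {p : (ℝ≥0 × E) × (ℕ → E) | Tendsto p.2 (comap q (𝓝 p.1.1)) (𝓝 p.1.2)} =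
      ⋂ k : ℕ, ⋃ m : ℕ, ⋂ n : ℕ, {p : (ℝ≥0 × E) × (ℕ → E) |
        (1 : ℝ) / (m + 1) ≤ dist (q n) p.1.1} ∪ {p : (ℝ≥0 × E) × (ℕ → E) |
        dist (p.2 n) p.1.2 < 1 / (k + 1)} := by
    ext p
    rw [mem_ofPred_eq, ((Metric.nhds_basis_ball_inv_nat_succ (x := p.1.1)).comap q).tendsto_iff
      Metric.nhds_basis_ball_inv_nat_succ]
    simp only [mem_iInter, mem_iUnion, mem_union, mem_ofPred_eq, true_and, true_imp_iff,
      mem_preimage, Metric.mem_ball]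
    refine forall_congr' fun k => exists_congr fun m => forall_congr' fun n => ?_
    rw [← not_lt, imp_iff_not_or]
  rw [h]
  refine MeasurableSet.iInter fun k => MeasurableSet.iUnion fun m => MeasurableSet.iInter fun n =>
    MeasurableSet.union (measurableSet_le (by fun_prop) (by fun_prop))
      (measurableSet_lt ?_ (by fun_prop))
  exact ((measurable_pi_apply n).comp measurable_snd).dist (measurable_snd.comp measurable_fst)

variable [mΩ : MeasurableSpace Ω]

/-- The graph of a continuous process meets a Borel set of `[0, b] × E` on an event of the
augmented past at time `b`. -/
theorem measurableSet_augment_exists_le {X : ℝ≥0 → Ω → E} {P : Kernel E Ω} [IsMarkovKernel P]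
    (hX : IsDiffusion X P) {D : Set (ℝ≥0 × E)} (hD : MeasurableSet D) (b : ℝ≥0) :
    MeasurableSet[augment X P (pastSigma X b)] {ω | ∃ s ≤ b, (s, X s ω) ∈ D} := by
  obtain ⟨q, hqb, hq⟩ := exists_dense_seq_Iic b
  -- `M` consists of a time, a value and a trace on the times `q n` that determines this value, with
  -- time and value in `D`. Its projection to the traces is analytic, and the trace of `X` is
  -- measurable for the past at `b`.
  let M : Set ((ℝ≥0 × E) × (ℕ → E)) :=
    {p | Tendsto p.2 (comap q (𝓝 p.1.1)) (𝓝 p.1.2)} ∩ {p | p.1 ∈ D} ∩ {p | p.1.1 ≤ b}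
  have hM : MeasurableSet M := ((measurableSet_tendsto_comap q).inter (measurable_fst hD)).inter
    (measurableSet_le (by fun_prop) measurable_const)
  have hA : AnalyticSet (Prod.snd '' M) := hM.analyticSet_image measurable_snd
  have hY : Measurable[pastSigma X b] fun ω n => X (q n) ω :=
    @measurable_pi_lambda _ _ _ (pastSigma X b) _ _ fun n => measurable_pastSigma X (hqb n)
  have heq : {ω | ∃ s ≤ b, (s, X s ω) ∈ D} = (fun ω n => X (q n) ω) ⁻¹' (Prod.snd '' M) := by
    ext ω
    have hlim : ∀ s, Tendsto (fun n => X (q n) ω) (comap q (𝓝 s)) (𝓝 (X s ω)) := fun s =>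
      ((hX.continuous_paths ω).tendsto s).comp tendsto_comap
    constructor
    · rintro ⟨s, hs, hsD⟩
      exact ⟨((s, X s ω), _), ⟨⟨hlim s, hsD⟩, hs⟩, rfl⟩
    · rintro ⟨⟨⟨s, z⟩, y⟩, ⟨⟨hl, hsD⟩, hs⟩, rfl⟩
      have := hq s hs
      have hz : z = X s ω := tendsto_nhds_unique hl (hlim s)
      exact ⟨s, hs, hz ▸ hsD⟩
  rw [heq]
  exact measurableSet_augment_preimage hX.measurable P (pastSigma_le X b) hY hA

end

/-! ### The Markov property at a fixed time for measures on the path space. -/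

section
variable {Ω E : Type*} [mE : MeasurableSpace E]

/-- Under `m`, the process restarts at time `u` according to `P`. -/
def MarkovAt [MeasurableSpace Ω] (X : ℝ≥0 → Ω → E) (P : Kernel E Ω) (m : Measure Ω) (u : ℝ≥0) :
    Prop :=
  ∀ (s : ℝ≥0) (A : Set Ω), MeasurableSet[pastSigma X u] A → ∀ B : Set E, MeasurableSet B →
    m (A ∩ X (u + s) ⁻¹' B) = ∫⁻ ω in A, P (X u ω) (X s ⁻¹' B) ∂m

variable [mΩ : MeasurableSpace Ω] {X : ℝ≥0 → Ω → E} {P : Kernel E Ω} {m : Measure Ω} {u : ℝ≥0}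

theorem pastSigma_le_of_measurable (hX : ∀ t, Measurable (X t)) (t : ℝ≥0) : pastSigma X t ≤ mΩ :=
  (pastSigma_le X t).trans (processSigma_le hX)

theorem measurable_transition (hX : ∀ t, Measurable (X t)) (s : ℝ≥0) {B : Set E}
    (hB : MeasurableSet B) : Measurable fun x => P x (X s ⁻¹' B) :=
  P.measurable_coe (hX s hB)

/-- Restricting `m` to the future event and weighting `m` by its transition probability give
measures that agree on `pastSigma X u`, hence the same integral of any `h` measurable there. -/
theorem MarkovAt.lintegral_eq (hX : ∀ t, Measurable (X t)) (hm : MarkovAt X P m u) (s : ℝ≥0)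
    {B : Set E} (hB : MeasurableSet B) {h : Ω → ℝ≥0∞} (hh : Measurable[pastSigma X u] h) :
    ∫⁻ ω in X (u + s) ⁻¹' B, h ω ∂m = ∫⁻ ω, h ω * P (X u ω) (X s ⁻¹' B) ∂m := by
  have hle := pastSigma_le_of_measurable hX u
  have hp : Measurable fun ω => P (X u ω) (X s ⁻¹' B) := (measurable_transition hX s hB).comp (hX u)
  have heq : (m.restrict (X (u + s) ⁻¹' B)).trim hle =
      (m.withDensity fun ω => P (X u ω) (X s ⁻¹' B)).trim hle := by
    refine @Measure.ext _ (pastSigma X u) _ _ fun A hA => ?_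
    rw [trim_measurableSet_eq hle hA, trim_measurableSet_eq hle hA,
      withDensity_apply _ (hle _ hA), ← hm s A hA B hB, Measure.restrict_apply (hle _ hA)]
  rw [← lintegral_trim hle hh, heq, lintegral_trim hle hh,
    lintegral_withDensity_eq_lintegral_mul _ hp (hh.mono hle le_rfl)]
  simp [mul_comm]

/-- A density depending only on the past does not change the conditional law of the future. -/
theorem MarkovAt.withDensity (hX : ∀ t, Measurable (X t)) (hm : MarkovAt X P m u)
    {h : Ω → ℝ≥0∞} (hh : Measurable[pastSigma X u] h) : MarkovAt X P (m.withDensity h) u := by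
  intro s A hA B hB
  have hle := pastSigma_le_of_measurable hX u
  have hp : Measurable fun ω => P (X u ω) (X s ⁻¹' B) := (measurable_transition hX s hB).comp (hX u)
  have h1 := hm.lintegral_eq hX s hB (hh.indicator hA)
  rw [withDensity_apply _ ((hle _ hA).inter (hX _ hB)),
    setLIntegral_withDensity_eq_setLIntegral_mul _ (hh.mono hle le_rfl) hp (hle _ hA),
    ← Measure.restrict_restrict (hle _ hA), ← lintegral_indicator (hle _ hA), h1,
    ← lintegral_indicator (hle _ hA)]
  refine lintegral_congr fun ω => ?_
  by_cases hω : ω ∈ A <;> simp [hω]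

theorem MarkovAt.restrict (hX : ∀ t, Measurable (X t)) (hm : MarkovAt X P m u) {C : Set Ω}
    (hC : MeasurableSet[pastSigma X u] C) : MarkovAt X P (m.restrict C) u := by
  rw [← withDensity_indicator_one (pastSigma_le_of_measurable hX u _ hC)]
  exact hm.withDensity hX ((@measurable_const _ _ _ (pastSigma X u) (1 : ℝ≥0∞)).indicator hC)

/-- As an identity between laws on `E`, the property can be tested on continuous functions and so
passes to limits; `markovAt_of_map_eq` is the way back. -/
theorem MarkovAt.map_eq (hX : ∀ t, Measurable (X t)) (hm : MarkovAt X P m u) (s : ℝ≥0)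
    {A : Set Ω} (hA : MeasurableSet[pastSigma X u] A) :
    (m.restrict A).map (X (u + s)) = ((m.restrict A).map (X u)).bind (P.map (X s)) := by
  ext B hB
  have hle := pastSigma_le_of_measurable hX u
  rw [Measure.map_apply (hX _) hB, Measure.restrict_apply (hX _ hB), inter_comm, hm s A hA B hB,
    Measure.bind_apply hB (Kernel.aemeasurable _),
    lintegral_map (Kernel.measurable_coe _ hB) (hX u)]
  simp_rw [Kernel.map_apply _ (hX s), Measure.map_apply (hX s) hB]

theorem markovAt_of_map_eq (hX : ∀ t, Measurable (X t))
    (h : ∀ (s : ℝ≥0) (A : Set Ω), MeasurableSet[pastSigma X u] A →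
      (m.restrict A).map (X (u + s)) = ((m.restrict A).map (X u)).bind (P.map (X s))) :
    MarkovAt X P m u := by
  intro s A hA B hB
  have h1 := congrArg (fun ρ => ρ B) (h s A hA)
  rw [Measure.map_apply (hX _) hB, Measure.restrict_apply (hX _ hB), inter_comm,
    Measure.bind_apply hB (Kernel.aemeasurable _),
    lintegral_map (Kernel.measurable_coe _ hB) (hX u)] at h1
  simp_rw [Kernel.map_apply _ (hX s), Measure.map_apply (hX s) hB] at h1
  exact h1

end

section
variable {Ω E : Type*} [TopologicalSpace E] [MeasurableSpace E]
  [mΩ : MeasurableSpace Ω] {X : ℝ≥0 → Ω → E} {P : Kernel E Ω}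

/-- This is the strong Markov property at the constant time `u`, integrated over the starting point.
-/
theorem IsDiffusion.markovAt (hX : IsDiffusion X P) (ν : Measure E) (u : ℝ≥0) :
    MarkovAt X P (ν.bind P) u := by
  intro s A hA B hB
  have hle := pastSigma_le_of_measurable hX.measurable u
  have hA' : MeasurableSet[(isStoppingTime_const (completedFiltration X P) u).measurableSpace] A := by
    rw [IsStoppingTime.measurableSpace_const]
    exact fun ν _ => ⟨A, ∅, hA, @MeasurableSet.empty _ (processSigma X), measure_empty, by simp⟩
  have hp : Measurable fun ω => P (X u ω) (X s ⁻¹' B) :=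
    (measurable_transition hX.measurable s hB).comp (hX.measurable u)
  rw [Measure.bind_apply ((hle _ hA).inter (hX.measurable _ hB)) (Kernel.aemeasurable _),
    ← lintegral_indicator (hle _ hA), Measure.lintegral_bind (Kernel.aemeasurable _)
      (hp.indicator (hle _ hA)).aemeasurable]
  refine lintegral_congr fun x => ?_
  have h := hX.strong_markov _ (isStoppingTime_const (completedFiltration X P) u) A hA' s B hB x
  simp only [ne_eq, WithTop.coe_ne_top, not_false_eq_true, true_and, WithTop.untopD_coe, ofPred_true,
    inter_univ] at h
  rwa [lintegral_indicator (hle _ hA)]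

end

theorem integral_bind_of_bounded {F G : Type*} [MeasurableSpace F] [MeasurableSpace G]
    {κ : Kernel F G} [IsMarkovKernel κ] {μ : Measure F} [IsFiniteMeasure μ] {φ : G → ℝ}
    (hφ : Measurable φ) {C : ℝ} (hC : ∀ y, ‖φ y‖ ≤ C) :
    ∫ y, φ y ∂(μ.bind κ) = ∫ x, ∫ y, φ y ∂κ x ∂μ := by
  have hb : IsFiniteMeasure (μ.bind κ) := by
    rw [Measure.comp_eq_comp_const_apply]
    infer_instance
  have hi : Integrable φ (μ.bind κ) :=
    Integrable.of_bound hφ.aestronglyMeasurable C (Eventually.of_forall hC)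
  rw [Measure.comp_eq_comp_const_apply] at hi ⊢
  rw [Kernel.integral_comp hi]
  rfl

section
variable {Ω E : Type*} [MetricSpace E] [ProperSpace E] [MeasurableSpace E] [BorelSpace E]
  [mΩ : MeasurableSpace Ω] {X : ℝ≥0 → Ω → E} {P : Kernel E Ω} [IsMarkovKernel P]

/-- The laws are tested on compactly supported `φ`. The Feller property makes `ψ = P_s φ`
continuous, so both sides at times `t + ε n` converge by path continuity and bounded convergence; an
event of the past at `t` is in the past at `t + ε n`. -/
theorem IsDiffusion.markovAt_of_forall_gt (hX : IsDiffusion X P) {m : Measure Ω}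
    [IsFiniteMeasure m] {t : ℝ≥0} (h : ∀ u > t, MarkovAt X P m u) : MarkovAt X P m t := by
  have hXm := hX.measurable
  refine markovAt_of_map_eq hXm fun s A hA => ?_
  have : IsMarkovKernel (P.map (X s)) := Kernel.IsMarkovKernel.map _ (hXm s)
  refine Measure.ext_of_integral_eq_on_compactlySupported fun φ₀ => ?_
  let φ : C₀(E, ℝ) := φ₀
  change ∫ x, φ x ∂_ = ∫ x, φ x ∂_
  have hbd : ∀ φ : C₀(E, ℝ), ∀ x, ‖φ x‖ ≤ ‖φ.toBCF‖ := fun φ x => φ.toBCF.norm_coe_le_norm x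
  obtain ⟨ψ, hψ⟩ := hX.feller s φ
  have hφc : Continuous fun x => φ x := map_continuous φ
  have hψc : Continuous fun x => ψ x := map_continuous ψ
  have hmap : ∀ x, ∫ y, φ y ∂(P.map (X s)) x = ψ x := fun x => by
    rw [hψ, Kernel.map_apply _ (hXm s),
      integral_map (hXm s).aemeasurable hφc.aestronglyMeasurable]
  rw [integral_bind_of_bounded hφc.measurable (hbd φ)]
  simp_rw [hmap]
  rw [integral_map (hXm _).aemeasurable hφc.aestronglyMeasurable,
    integral_map (hXm _).aemeasurable hψc.aestronglyMeasurable]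
  obtain ⟨ε, -, hε, hεlim⟩ := exists_seq_strictAnti_tendsto (0 : ℝ≥0)
  have hlim : ∀ (χ : C₀(E, ℝ)) (a : ℝ≥0), Tendsto (fun n => ∫ ω in A, χ (X (a + ε n) ω) ∂m) atTop
      (𝓝 (∫ ω in A, χ (X a ω) ∂m)) := by
    intro χ a
    have hχc : Continuous fun x => χ x := map_continuous χ
    refine tendsto_integral_of_dominated_convergence (fun _ => ‖χ.toBCF‖)
      (fun n => (hχc.measurable.comp (hXm _)).aestronglyMeasurable)
      (integrable_const _) (fun n => Eventually.of_forall fun ω => hbd χ _)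
      (Eventually.of_forall fun ω => ?_)
    refine ((hχc.comp (hX.continuous_paths ω)).tendsto a).comp ?_
    simpa using tendsto_const_nhds.add hεlim
  refine tendsto_nhds_unique (hlim φ (t + s)) ((hlim ψ t).congr fun n => ?_)
  have h2 := (h (t + ε n) (lt_add_of_pos_right t (hε n))).map_eq hXm s
    (pastSigma_mono X le_self_add A hA)
  have h3 := congrArg (fun ρ => ∫ x, φ x ∂ρ) h2
  rw [integral_bind_of_bounded hφc.measurable (hbd φ)] at h3
  simp_rw [hmap] at h3
  rw [integral_map (hXm _).aemeasurable hφc.aestronglyMeasurable,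
    integral_map (hXm _).aemeasurable hψc.aestronglyMeasurable] at h3
  rw [← h3, add_right_comm]

end

/-! ### Uniqueness of a measure that is Markov from time `t` on. -/

section
variable {Ω E : Type*} [mE : MeasurableSpace E]

/-- Intersections of sets of two `σ`-fields form a `π`-system that generates their join. -/
theorem generateFrom_inter_eq_sup (𝓖 𝓗 : MeasurableSpace Ω) :
    𝓖 ⊔ 𝓗 = MeasurableSpace.generateFrom
      {s | ∃ A B, MeasurableSet[𝓖] A ∧ MeasurableSet[𝓗] B ∧ A ∩ B = s} := by
  refine le_antisymm (sup_le (fun A hA => ?_) fun B hB => ?_)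
    (MeasurableSpace.generateFrom_le ?_)
  · exact MeasurableSpace.measurableSet_generateFrom
      ⟨A, univ, hA, @MeasurableSet.univ _ 𝓗, inter_univ A⟩
  · exact MeasurableSpace.measurableSet_generateFrom
      ⟨univ, B, @MeasurableSet.univ _ 𝓖, hB, univ_inter B⟩
  · rintro _ ⟨A, B, hA, hB, rfl⟩
    exact MeasurableSet.inter ((le_sup_left : 𝓖 ≤ 𝓖 ⊔ 𝓗) _ hA) ((le_sup_right : 𝓗 ≤ 𝓖 ⊔ 𝓗) _ hB)

theorem isPiSystem_inter (𝓖 𝓗 : MeasurableSpace Ω) :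
    IsPiSystem {s | ∃ A B, MeasurableSet[𝓖] A ∧ MeasurableSet[𝓗] B ∧ A ∩ B = s} := by
  rintro _ ⟨A, B, hA, hB, rfl⟩ _ ⟨A', B', hA', hB', rfl⟩ -
  exact ⟨A ∩ A', B ∩ B', hA.inter hA', hB.inter hB', by
    rw [inter_inter_inter_comm]⟩

theorem measure_eq_of_sup [mΩ : MeasurableSpace Ω] {m₁ m₂ : Measure Ω} [IsFiniteMeasure m₁]
    {𝓖 𝓗 : MeasurableSpace Ω} (h𝓖 : 𝓖 ≤ mΩ) (h𝓗 : 𝓗 ≤ mΩ)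
    (h : ∀ A B, MeasurableSet[𝓖] A → MeasurableSet[𝓗] B → m₁ (A ∩ B) = m₂ (A ∩ B))
    {D : Set Ω} (hD : MeasurableSet[𝓖 ⊔ 𝓗] D) : m₁ D = m₂ D := by
  have hle : 𝓖 ⊔ 𝓗 ≤ mΩ := sup_le h𝓖 h𝓗
  have huniv : m₁ univ = m₂ univ := by
    simpa using h univ univ (@MeasurableSet.univ _ 𝓖) (@MeasurableSet.univ _ 𝓗)
  have := isFiniteMeasure_trim (μ := m₁) hle
  have key : m₁.trim hle = m₂.trim hle := by
    refine @ext_of_generate_finite _ (𝓖 ⊔ 𝓗) _ _ _ (generateFrom_inter_eq_sup 𝓖 𝓗)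
      (isPiSystem_inter 𝓖 𝓗) _ ?_ ?_
    · rintro _ ⟨A, B, hA, hB, rfl⟩
      have hAB : MeasurableSet[𝓖 ⊔ 𝓗] (A ∩ B) :=
        MeasurableSet.inter ((le_sup_left : 𝓖 ≤ 𝓖 ⊔ 𝓗) _ hA) ((le_sup_right : 𝓗 ≤ 𝓖 ⊔ 𝓗) _ hB)
      rw [trim_measurableSet_eq hle hAB, trim_measurableSet_eq hle hAB]
      exact h A B hA hB
    · rw [trim_measurableSet_eq hle (@MeasurableSet.univ _ _),
        trim_measurableSet_eq hle (@MeasurableSet.univ _ _), huniv]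
  rw [← trim_measurableSet_eq hle hD, key, trim_measurableSet_eq hle hD]

/-- The `σ`-field generated by the past at time `t` and finitely many further variables. -/
@[reducible] def finiteSigma (X : ℝ≥0 → Ω → E) (t : ℝ≥0) (F : Finset ℝ≥0) : MeasurableSpace Ω :=
  pastSigma X t ⊔ ⨆ s ∈ F, MeasurableSpace.comap (X s) mE

theorem finiteSigma_mono (X : ℝ≥0 → Ω → E) (t : ℝ≥0) : Monotone (finiteSigma X t) :=
  fun _ _ h => sup_le_sup_left (biSup_mono h) _

theorem finiteSigma_insert (X : ℝ≥0 → Ω → E) (t a : ℝ≥0) (F : Finset ℝ≥0) :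
    finiteSigma X t (insert a F) = finiteSigma X t F ⊔ MeasurableSpace.comap (X a) mE := by
  rw [finiteSigma, Finset.iSup_insert, finiteSigma, sup_comm (MeasurableSpace.comap _ _), sup_assoc]

theorem iSup_finiteSigma (X : ℝ≥0 → Ω → E) (t : ℝ≥0) :
    ⨆ F, finiteSigma X t F = processSigma X := by
  refine le_antisymm (iSup_le fun F => sup_le (pastSigma_le X t) (iSup_mono fun s =>
    iSup_le fun _ => le_rfl)) (iSup_le fun s => ?_)
  refine le_iSup_of_le {s} (le_sup_of_le_right ?_)
  exact le_iSup₂_of_le s (Finset.mem_singleton_self s) le_rfl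

variable [mΩ : MeasurableSpace Ω] {X : ℝ≥0 → Ω → E} {P : Kernel E Ω}

/-- Times are added in increasing order. The Markov property at the last earlier time `u` turns the
measure of `A ∩ {X_a ∈ B}` into the integral over `A` of a function of `X u`, to which the induction
hypothesis applies. -/
theorem measure_eq_of_finiteSigma (hX : ∀ t, Measurable (X t)) {m₁ m₂ : Measure Ω}
    [IsFiniteMeasure m₁] {t : ℝ≥0} (h₁ : ∀ u ≥ t, MarkovAt X P m₁ u)
    (h₂ : ∀ u ≥ t, MarkovAt X P m₂ u)
    (h : ∀ A, MeasurableSet[pastSigma X t] A → m₁ A = m₂ A) (F : Finset ℝ≥0) :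
    ∀ A, MeasurableSet[finiteSigma X t F] A → m₁ A = m₂ A := by
  have hle : ∀ F, finiteSigma X t F ≤ mΩ := fun F =>
    sup_le (pastSigma_le_of_measurable hX t) (iSup₂_le fun s _ => (hX s).comap_le)
  induction F using Finset.induction_on_max with
  | empty =>
    have h0 : finiteSigma X t ∅ = pastSigma X t := by simp [finiteSigma]
    rwa [h0]
  | insert a F hmax ih =>
    rw [finiteSigma_insert]
    intro D hD
    rcases le_total a t with hat | hta
    · have : finiteSigma X t F ⊔ MeasurableSpace.comap (X a) mE = finiteSigma X t F :=
        sup_eq_left.2 (le_sup_of_le_left (le_iSup₂_of_le a hat le_rfl))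
      exact ih D (this ▸ hD)
    obtain ⟨u, htu, hua, hu, hFu⟩ : ∃ u, t ≤ u ∧ u ≤ a ∧ Measurable[finiteSigma X t F] (X u) ∧
        finiteSigma X t F ≤ pastSigma X u := by
      -- Inserting `t` makes `u ≥ t`, and `u` is attained as `t` or as an element of `F`, so `X u`
      -- is measurable for `finiteSigma X t F`.
      refine ⟨(insert t F).sup id, Finset.le_sup (f := id) (Finset.mem_insert_self t F), ?_, ?_, ?_⟩
      · refine Finset.sup_le fun s hs => ?_
        rcases Finset.mem_insert.1 hs with rfl | hs
        exacts [hta, (hmax s hs).le]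
      · obtain ⟨s, hs, hs'⟩ := Finset.exists_mem_eq_sup _ (Finset.insert_nonempty t F) id
        rw [hs', id, measurable_iff_comap_le]
        rcases Finset.mem_insert.1 hs with rfl | hs
        · exact le_sup_of_le_left (le_iSup₂_of_le s le_rfl le_rfl)
        · exact le_sup_of_le_right (le_iSup₂_of_le s hs le_rfl)
      · refine sup_le (pastSigma_mono X (Finset.le_sup (f := id) (Finset.mem_insert_self t F)))
          (iSup₂_le fun s hs => ?_)
        exact le_iSup₂_of_le s (Finset.le_sup (f := id) (Finset.mem_insert_of_mem hs)) le_rfl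
    obtain ⟨s, rfl⟩ := exists_add_of_le hua
    refine measure_eq_of_sup (hle F) (hX _).comap_le ?_ hD
    rintro A _ hA ⟨B, hB, rfl⟩
    have htrim : m₁.trim (hle F) = m₂.trim (hle F) :=
      @Measure.ext _ (finiteSigma X t F) _ _ fun A hA => by
        rw [trim_measurableSet_eq (hle F) hA, trim_measurableSet_eq (hle F) hA, ih A hA]
    have hp : Measurable[finiteSigma X t F] fun ω => P (X u ω) (X s ⁻¹' B) :=
      (measurable_transition hX s hB).comp hu
    rw [h₁ u htu s A (hFu _ hA) B hB, h₂ u htu s A (hFu _ hA) B hB,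
      ← setLIntegral_trim (hle F) hp hA, htrim, setLIntegral_trim (hle F) hp hA]

/-- The `σ`-fields `finiteSigma X t F` are directed in `F`, so their union is a `π`-system
generating `processSigma X`. -/
theorem measure_eq_of_markovAt (hX : ∀ t, Measurable (X t)) {m₁ m₂ : Measure Ω}
    [IsFiniteMeasure m₁] {t : ℝ≥0} (h₁ : ∀ u ≥ t, MarkovAt X P m₁ u)
    (h₂ : ∀ u ≥ t, MarkovAt X P m₂ u)
    (h : ∀ A, MeasurableSet[pastSigma X t] A → m₁ A = m₂ A) {D : Set Ω}
    (hD : MeasurableSet[processSigma X] D) : m₁ D = m₂ D := by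
  have hF := measure_eq_of_finiteSigma hX h₁ h₂ h
  have hle := processSigma_le hX
  have hgen : processSigma X =
      MeasurableSpace.generateFrom {A | ∃ F, MeasurableSet[finiteSigma X t F] A} := by
    rw [← iSup_finiteSigma X t]
    exact MeasurableSpace.measurableSpace_iSup_eq _
  have hpi : IsPiSystem {A | ∃ F, MeasurableSet[finiteSigma X t F] A} := by
    rintro A ⟨F, hA⟩ B ⟨G, hB⟩ -
    exact ⟨F ∪ G, (finiteSigma_mono X t Finset.subset_union_left _ hA).inter
      (finiteSigma_mono X t Finset.subset_union_right _ hB)⟩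
  have := isFiniteMeasure_trim (μ := m₁) hle
  have key : m₁.trim hle = m₂.trim hle := by
    refine @ext_of_generate_finite _ (processSigma X) _ _ _ hgen hpi _ ?_ ?_
    · rintro A ⟨F, hA⟩
      have hA' : MeasurableSet[processSigma X] A := by
        rw [← iSup_finiteSigma X t]
        exact le_iSup (finiteSigma X t) F _ hA
      rw [trim_measurableSet_eq hle hA', trim_measurableSet_eq hle hA', hF F A hA]
    · rw [trim_measurableSet_eq hle (@MeasurableSet.univ _ _),
        trim_measurableSet_eq hle (@MeasurableSet.univ _ _), hF ∅ _ (@MeasurableSet.univ _ _)]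
  rw [← trim_measurableSet_eq hle hD, key, trim_measurableSet_eq hle hD]

end

/-! ### Right-continuity of the completed filtration and hitting times. -/

section
variable {Ω E : Type*} [MetricSpace E] [ProperSpace E] [MeasurableSpace E] [BorelSpace E]
  [mΩ : MeasurableSpace Ω] {X : ℝ≥0 → Ω → E} {P : Kernel E Ω} [IsMarkovKernel P]

/-- The completed filtration of a diffusion is right-continuous. -/
theorem IsDiffusion.measurableSet_augment_of_forall_gt (hX : IsDiffusion X P) {t : ℝ≥0} {A : Set Ω}
    (hA : ∀ u > t, MeasurableSet[augment X P (pastSigma X u)] A) :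
    MeasurableSet[augment X P (pastSigma X t)] A := by
  intro ν hν
  have hXm := hX.measurable
  have hle := pastSigma_le_of_measurable hXm t
  have hle' := processSigma_le hXm
  set μ := ν.bind P with hμ
  have hfin : IsFiniteMeasure μ := by
    rw [hμ, Measure.comp_eq_comp_const_apply]
    infer_instance
  have hA' : ∀ u > t, ∃ B, MeasurableSet[pastSigma X u] B ∧ A =ᵐ[μ] B := fun u hu => by
    obtain ⟨B, N, hB, -, hN0, hAB⟩ := hA u hu ν hν
    exact ⟨B, hB, measure_symmDiff_eq_zero_iff.1 (measure_mono_null hAB hN0)⟩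
  obtain ⟨B₀, N, hB₀, hN, hN0, hAB⟩ := hA (t + 1) (lt_add_of_pos_right t one_pos) ν hν
  replace hB₀ := pastSigma_le X _ _ hB₀
  have hAB₀ : A =ᵐ[μ] B₀ := measure_symmDiff_eq_zero_iff.1 (measure_mono_null hAB hN0)
  set h : Ω → ℝ≥0∞ := condLExp (pastSigma X t) μ (B₀.indicator 1) with hh
  have hhm : Measurable[pastSigma X t] h := measurable_condLExp _ _ _
  have hhm' : Measurable h := hhm.mono hle le_rfl
  have := isFiniteMeasure_trim (μ := μ) hle
  have hagree : ∀ C, MeasurableSet[pastSigma X t] C → μ.restrict B₀ C = μ.withDensity h C := by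
    intro C hC
    rw [withDensity_apply _ (hle _ hC), hh, setLIntegral_condLExp hle _ _ hC,
      lintegral_indicator_one (hle' _ hB₀), Measure.restrict_apply (hle _ hC),
      Measure.restrict_apply (hle' _ hB₀), inter_comm]
  -- For each `u > t` the event `A` is almost surely an event of the past at `u`, so restricting to
  -- it preserves the Markov property at `u`; the Feller limit then reaches `u = t`.
  have h₁' : ∀ u > t, MarkovAt X P (μ.restrict B₀) u := by
    intro u hu
    obtain ⟨B, hB, hAB'⟩ := hA' u hu
    rw [Measure.restrict_congr_set (hAB₀.symm.trans hAB')]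
    exact (hX.markovAt ν u).restrict hXm hB
  have h₁ : ∀ u ≥ t, MarkovAt X P (μ.restrict B₀) u := fun u hu => by
    rcases hu.lt_or_eq with hu | rfl
    exacts [h₁' u hu, hX.markovAt_of_forall_gt h₁']
  have h₂ : ∀ u ≥ t, MarkovAt X P (μ.withDensity h) u := fun u hu =>
    (hX.markovAt ν u).withDensity hXm (hhm.mono (pastSigma_mono X hu) le_rfl)
  have key : ∀ D, MeasurableSet[processSigma X] D → μ (D ∩ B₀) = ∫⁻ ω in D, h ω ∂μ := by
    intro D hD
    rw [← withDensity_apply _ (hle' _ hD), ← Measure.restrict_apply (hle' _ hD)]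
    exact measure_eq_of_markovAt hXm h₁ h₂ hagree hD
  -- In `key`, `D = {h = 0}` shows that `B₀ ∩ {h = 0}` is null, and `D = B₀ᶜ` that `h = 0` almost
  -- everywhere off `B₀`. Hence `B₀` is almost surely the event `{h ≠ 0}` of the past at `t`.
  have hC : MeasurableSet[pastSigma X t] (h ⁻¹' {0}) := hhm (measurableSet_singleton 0)
  have hC' := pastSigma_le X t _ hC
  have hz₁ : μ (B₀ ∩ h ⁻¹' {0}) = 0 := by
    rw [inter_comm, key _ hC', setLIntegral_congr_fun (hle _ hC) (g := 0) fun ω hω => hω]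
    simp
  have hz₂ : μ (B₀ᶜ ∩ (h ⁻¹' {0})ᶜ) = 0 := by
    have h0 := key _ hB₀.compl
    rw [compl_inter_self, measure_empty, eq_comm, lintegral_eq_zero_iff hhm',
      Filter.EventuallyEq, ae_restrict_iff' (hle' _ hB₀).compl] at h0
    refine measure_mono_null (fun ω hω => ?_) h0
    intro hcon
    exact hω.2 (hcon hω.1)
  refine ⟨(h ⁻¹' {0})ᶜ, N ∪ (B₀ ∩ h ⁻¹' {0} ∪ B₀ᶜ ∩ (h ⁻¹' {0})ᶜ), hC.compl,
    hN.union ((hB₀.inter hC').union (hB₀.compl.inter hC'.compl)),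
    measure_union_null hN0 (measure_union_null hz₁ hz₂), fun ω hω => ?_⟩
  have := @hAB ω
  simp only [mem_symmDiff, mem_union, mem_inter_iff, mem_compl_iff] at *
  tauto

/-- The first time at which the graph of a diffusion meets a Borel set is a stopping time. -/
theorem IsDiffusion.isStoppingTime_hittingAfter_graph (hX : IsDiffusion X P) {D : Set (ℝ≥0 × E)}
    (hD : MeasurableSet D) :
    IsStoppingTime (completedFiltration X P) (hittingAfter (fun s ω => (s, X s ω)) D 0) := by
  intro t
  -- The infimum need not be attained, so hitting by `t` is expressed through hitting by the later
  -- times `v n`; right-continuity brings the event back to `t`.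
  refine hX.measurableSet_augment_of_forall_gt fun u hu => ?_
  obtain ⟨v, hv, hvu, hvlim⟩ := exists_seq_strictAnti_tendsto' hu
  have heq : {ω | hittingAfter (fun s ω => (s, X s ω)) D 0 ω ≤ t} =
      ⋂ n, {ω | ∃ s ≤ v n, (s, X s ω) ∈ D} := by
    ext ω
    simp only [mem_ofPred_eq, mem_iInter]
    constructor
    · intro h n
      have h2 := (h.trans_lt (WithTop.coe_lt_coe.2 (hvu n).1))
      rw [hittingAfter_lt_iff] at h2
      obtain ⟨s, hs, hsD⟩ := h2
      exact ⟨s, hs.2.le, hsD⟩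
    · intro h
      refine ge_of_tendsto' (((WithTop.continuous_coe).tendsto t).comp hvlim) fun n => ?_
      obtain ⟨s, hs, hsD⟩ := h n
      exact (hittingAfter_le_of_mem (u := fun s ω => (s, X s ω)) zero_le hsD).trans (WithTop.coe_le_coe.2 hs)
  rw [heq]
  exact MeasurableSet.iInter fun n => augment_mono X P (pastSigma_mono X (hvu n).2.le) _
    (measurableSet_augment_exists_le hX hD (v n))

end

/-! ### Green potentials and the strong Markov property. -/

section
variable {Ω E : Type*}

/-- `∫_a^∞ e^{-rt} u(X_t) dt`. -/
noncomputable def discountedTail (X : ℝ≥0 → Ω → E) (r : ℝ) (u : E → ℝ≥0∞) (ω : Ω) (a : ℝ) : ℝ≥0∞ :=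
  ∫⁻ t in Ici a, ENNReal.ofReal (Real.exp (-(r * t))) * u (X t.toNNReal ω)

theorem discountedTail_eq_shift (X : ℝ≥0 → Ω → E) (r : ℝ) (u : E → ℝ≥0∞) (ω : Ω) (a : ℝ≥0) :
    discountedTail X r u ω a = ∫⁻ t in Ici (0 : ℝ),
      ENNReal.ofReal (Real.exp (-(r * a))) * (ENNReal.ofReal (Real.exp (-(r * t))) *
        u (X (a + t.toNNReal) ω)) := by
  rw [discountedTail, ← lintegral_indicator measurableSet_Ici, ← lintegral_indicator
    measurableSet_Ici, ← lintegral_add_left_eq_self _ (a : ℝ)]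
  refine lintegral_congr fun t => ?_
  by_cases ht : 0 ≤ t
  · have hat : (a : ℝ) + t ∈ Ici (a : ℝ) := mem_Ici.2 (by linarith)
    have hadd : ((a : ℝ) + t).toNNReal = a + t.toNNReal := by
      rw [Real.toNNReal_add a.coe_nonneg ht, Real.toNNReal_coe]
    rw [indicator_of_mem hat, indicator_of_mem (mem_Ici.2 ht), ← mul_assoc,
      ← ENNReal.ofReal_mul (Real.exp_nonneg _), ← Real.exp_add, hadd]
    ring_nf
  · have hat : (a : ℝ) + t ∉ Ici (a : ℝ) := fun h => ht (by linarith [mem_Ici.1 h])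
    rw [indicator_of_notMem hat, indicator_of_notMem (s := Ici (0 : ℝ)) ht]

theorem discountedTail_anti (X : ℝ≥0 → Ω → E) (r : ℝ) (u : E → ℝ≥0∞) (ω : Ω) :
    Antitone (discountedTail X r u ω) := fun _ _ h => lintegral_mono_set (Ici_subset_Ici.2 h)

end

section
variable {Ω E : Type*} [TopologicalSpace E] [MeasurableSpace E] [mΩ : MeasurableSpace Ω]
  {X : ℝ≥0 → Ω → E} {P : Kernel E Ω} {τ : Ω → WithTop ℝ≥0}

/-- The choice `ν = δ_x` in the definition of `augment` supplies the approximating set. -/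
theorem IsDiffusion.nullMeasurableSet (hX : IsDiffusion X P) (x : E) {A : Set Ω}
    (hA : MeasurableSet[augment X P (processSigma X)] A) : NullMeasurableSet A (P x) := by
  obtain ⟨B, N, hB, -, hN0, hAB⟩ := hA (Measure.dirac x) inferInstance
  rw [Measure.dirac_bind P.measurable] at hN0
  exact (processSigma_le hX.measurable _ hB).nullMeasurableSet.congr
    (measure_symmDiff_eq_zero_iff.1 (measure_mono_null hAB hN0)).symm

theorem IsDiffusion.nullMeasurableSet_le (hX : IsDiffusion X P) (x : E)
    (hτ : IsStoppingTime (completedFiltration X P) τ) (a : ℝ≥0) :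
    NullMeasurableSet {ω | τ ω ≤ a} (P x) :=
  hX.nullMeasurableSet x ((completedFiltration X P).le a _ (hτ a))

theorem IsDiffusion.nullMeasurableSet_ne_top (hX : IsDiffusion X P) (x : E)
    (hτ : IsStoppingTime (completedFiltration X P) τ) :
    NullMeasurableSet {ω | τ ω ≠ ⊤} (P x) := by
  have : {ω | τ ω ≠ ⊤} = ⋃ n : ℕ, {ω | τ ω ≤ ((n : ℝ≥0) : WithTop ℝ≥0)} := by
    ext ω
    simp only [mem_ofPred_eq, mem_iUnion]
    constructor
    · intro h
      lift τ ω to ℝ≥0 using h with t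
      obtain ⟨n, hn⟩ := exists_nat_ge t
      exact ⟨n, WithTop.coe_le_coe.2 hn⟩
    · rintro ⟨n, hn⟩
      exact ne_top_of_le_ne_top WithTop.coe_ne_top hn
  rw [this]
  exact NullMeasurableSet.iUnion fun n => hX.nullMeasurableSet_le x hτ n

theorem IsDiffusion.aemeasurable_untopD (hX : IsDiffusion X P) (x : E)
    (hτ : IsStoppingTime (completedFiltration X P) τ) :
    AEMeasurable (fun ω => (τ ω).untopD 0) (P x) := by
  refine NullMeasurable.aemeasurable ?_
  refine measurable_of_Iic (α := ℝ≥0) (δ := NullMeasurableSpace Ω (P x)) fun a => ?_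
  -- The default value `0` puts all of `{τ = ⊤}` into this preimage.
  have : (fun ω => (τ ω).untopD 0) ⁻¹' Iic a = {ω | τ ω ≤ a} ∪ {ω | τ ω ≠ ⊤}ᶜ := by
    ext ω
    cases h : τ ω with
    | top => simp [h]
    | coe t => simp only [mem_preimage, mem_Iic, mem_union, mem_ofPred_eq, mem_compl_iff, h,
        WithTop.untopD_coe, WithTop.coe_le_coe, ne_eq, WithTop.coe_ne_top, not_false_eq_true,
        not_true_eq_false, or_false]
  exact this ▸ (hX.nullMeasurableSet_le x hτ a).union (hX.nullMeasurableSet_ne_top x hτ).compl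

end

section
variable {Ω E : Type*} [MetricSpace E] [MeasurableSpace E] [BorelSpace E]
  [mΩ : MeasurableSpace Ω] {X : ℝ≥0 → Ω → E} {P : Kernel E Ω}

theorem IsDiffusion.measurable_uncurry (hX : IsDiffusion X P) : Measurable (Function.uncurry X) :=
  measurable_uncurry_of_continuous_of_measurable hX.continuous_paths hX.measurable

theorem IsDiffusion.measurable_comp (hX : IsDiffusion X P) {Z : Type*} [MeasurableSpace Z]
    {T : Z → ℝ≥0} (hT : Measurable T) {w : Z → Ω} (hw : Measurable w) :
    Measurable fun z => X (T z) (w z) :=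
  hX.measurable_uncurry.comp (hT.prodMk hw)

theorem IsDiffusion.measurable_discountedTail (hX : IsDiffusion X P) (r : ℝ) {u : E → ℝ≥0∞}
    (hu : Measurable u) (a : ℝ) : Measurable fun ω => discountedTail X r u ω a := by
  refine Measurable.lintegral_prod_right'
    (f := fun p : Ω × ℝ => ENNReal.ofReal (Real.exp (-(r * p.2))) * u (X p.2.toNNReal p.1)) ?_
  exact Measurable.mul (by fun_prop)
    (hu.comp (hX.measurable_comp (measurable_snd.real_toNNReal) measurable_fst))

variable [IsMarkovKernel P]

theorem IsDiffusion.lintegral_greenMeasure' (hX : IsDiffusion X P) (r : ℝ) (x : E) {u : E → ℝ≥0∞}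
    (hu : Measurable u) :
    ∫⁻ y, u y ∂(greenMeasure X P r x) = ∫⁻ t in Ici (0 : ℝ),
      ENNReal.ofReal (Real.exp (-(r * t))) * ∫⁻ ω, u (X t.toNNReal ω) ∂(P x) := by
  have hk : Measurable fun t : ℝ => (P x).map (X t.toNNReal) := by
    refine Measure.measurable_of_measurable_coe _ fun H hH => ?_
    simp_rw [Measure.map_apply (hX.measurable _) hH]
    exact (measurable_measure_prodMk_left (ν := P x) (hX.measurable_uncurry hH)).comp
      measurable_real_toNNReal
  rw [greenMeasure, Measure.lintegral_bind hk.aemeasurable hu.aemeasurable,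
    lintegral_withDensity_eq_lintegral_mul _ (by fun_prop)
      (g := fun t : ℝ => ∫⁻ y, u y ∂(P x).map (X t.toNNReal))
      ((Measure.measurable_lintegral hu).comp hk)]
  refine lintegral_congr fun t => ?_
  simp only [Pi.mul_apply]
  rw [lintegral_map hu (hX.measurable _)]

/-- The Green measure integrates `u ≥ 0` to `E_x ∫_0^∞ e^{-rt} u(X_t) dt`. -/
theorem IsDiffusion.lintegral_greenMeasure (hX : IsDiffusion X P) (r : ℝ) (x : E) {u : E → ℝ≥0∞}
    (hu : Measurable u) :
    ∫⁻ y, u y ∂(greenMeasure X P r x) = ∫⁻ ω, discountedTail X r u ω 0 ∂(P x) := by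
  rw [hX.lintegral_greenMeasure' r x hu]
  simp only [discountedTail]
  rw [lintegral_lintegral_swap]
  · refine lintegral_congr fun t => ?_
    rw [lintegral_const_mul (f := fun ω => u (X t.toNNReal ω)) _ (hu.comp (hX.measurable _))]
  · exact (Measurable.mul (by fun_prop)
      (hu.comp (hX.measurable_comp (measurable_snd.real_toNNReal) measurable_fst))).aemeasurable

theorem IsDiffusion.measurable_lintegral_transition (hX : IsDiffusion X P) {u : E → ℝ≥0∞}
    (hu : Measurable u) :
    Measurable fun p : ℝ × E => ∫⁻ ω, u (X p.1.toNNReal ω) ∂(P p.2) := by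
  refine Measurable.lintegral_kernel_prod_right
    (κ := P.comap (Prod.snd : ℝ × E → E) measurable_snd)
    (f := fun p ω => u (X p.1.toNNReal ω)) ?_
  exact hu.comp (hX.measurable_comp (measurable_fst.fst.real_toNNReal) measurable_snd)

/-- The Markov property at a measurable random time, tested on the events `T ≤ a`, extends to
discounted potentials. -/
theorem IsDiffusion.lintegral_greenMeasure_randomTime (hX : IsDiffusion X P) {μ : Measure Ω}
    [IsFiniteMeasure μ] {T : Ω → ℝ≥0} (hT : Measurable T)
    (h : ∀ (s : ℝ≥0) (B : Set E), MeasurableSet B → ∀ a,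
      μ ({ω | T ω ≤ a} ∩ {ω | X (T ω + s) ω ∈ B}) =
        ∫⁻ ω in {ω | T ω ≤ a}, P (X (T ω) ω) (X s ⁻¹' B) ∂μ)
    (r : ℝ) {u : E → ℝ≥0∞} (hu : Measurable u) :
    ∫⁻ ω, ENNReal.ofReal (Real.exp (-(r * T ω))) *
        ∫⁻ y, u y ∂(greenMeasure X P r (X (T ω) ω)) ∂μ =
      ∫⁻ ω, discountedTail X r u ω (T ω) ∂μ := by
  have hXT : Measurable fun ω => X (T ω) ω := hX.measurable_comp hT measurable_id
  have hXTs : ∀ s, Measurable fun ω => X (T ω + s) ω := fun s =>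
    hX.measurable_comp (hT.add_const s) measurable_id
  have he : Measurable fun a : ℝ≥0 => ENNReal.ofReal (Real.exp (-(r * a))) := by fun_prop
  have heT' : Measurable fun ω => ENNReal.ofReal (Real.exp (-(r * T ω))) := he.comp hT
  have hset : ∀ (s : ℝ≥0) (B : Set E), MeasurableSet B →
      ∫⁻ ω in {ω | X (T ω + s) ω ∈ B}, ENNReal.ofReal (Real.exp (-(r * T ω))) ∂μ =
        ∫⁻ ω, ENNReal.ofReal (Real.exp (-(r * T ω))) * P (X (T ω) ω) (X s ⁻¹' B) ∂μ := by
    intro s B hB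
    have hp : Measurable fun ω => P (X (T ω) ω) (X s ⁻¹' B) :=
      (measurable_transition hX.measurable s hB).comp hXT
    -- A law on the half-line is determined by the intervals `Iic a`, so the test events `T ≤ a`
    -- yield the weight `e^{-rT}`.
    have hρ : (μ.restrict {ω | X (T ω + s) ω ∈ B}).map T =
        (μ.withDensity fun ω => P (X (T ω) ω) (X s ⁻¹' B)).map T := by
      refine Measure.ext_of_Iic _ _ fun a => ?_
      rw [Measure.map_apply hT measurableSet_Iic, Measure.map_apply hT measurableSet_Iic,
        withDensity_apply _ (hT measurableSet_Iic),
        Measure.restrict_apply (hT measurableSet_Iic)]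
      exact h s B hB a
    rw [← lintegral_map he hT, hρ, lintegral_map he hT,
      lintegral_withDensity_eq_lintegral_mul _ hp heT']
    simp [mul_comm]
  have hfun : ∀ s : ℝ≥0,
      ∫⁻ ω, ENNReal.ofReal (Real.exp (-(r * T ω))) * u (X (T ω + s) ω) ∂μ =
        ∫⁻ ω, ENNReal.ofReal (Real.exp (-(r * T ω))) *
          ∫⁻ ω', u (X s ω') ∂(P (X (T ω) ω)) ∂μ := by
    intro s
    -- Under the weight `e^{-rT}` the law of `X_{T+s}` is the law of `X_T` moved by the transition
    -- kernel, which replaces the sets `B` by the function `u`.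
    have hρ : (μ.withDensity fun ω => ENNReal.ofReal (Real.exp (-(r * T ω)))).map
          (fun ω => X (T ω + s) ω) =
        ((μ.withDensity fun ω => ENNReal.ofReal (Real.exp (-(r * T ω)))).map
          (fun ω => X (T ω) ω)).bind (P.map (X s)) := by
      ext B hB
      rw [Measure.map_apply (hXTs s) hB, withDensity_apply _ (hXTs s hB),
        Measure.bind_apply hB (Kernel.aemeasurable _),
        lintegral_map (Kernel.measurable_coe _ hB) hXT,
        lintegral_withDensity_eq_lintegral_mul _ heT'
          (g := fun ω => P.map (X s) (X (T ω) ω) B) ((Kernel.measurable_coe _ hB).comp hXT)]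
      simp_rw [Pi.mul_apply, Kernel.map_apply _ (hX.measurable s),
        Measure.map_apply (hX.measurable s) hB]
      exact hset s B hB
    have h2 := congrArg (fun ρ => ∫⁻ y, u y ∂ρ) hρ
    rw [lintegral_map hu (hXTs s), lintegral_withDensity_eq_lintegral_mul _ heT'
      (g := fun ω => u (X (T ω + s) ω)) (hu.comp (hXTs s)),
      Measure.lintegral_bind (Kernel.aemeasurable _) hu.aemeasurable,
      lintegral_map hu.lintegral_kernel hXT, lintegral_withDensity_eq_lintegral_mul _ heT'
      (g := fun ω => ∫⁻ y, u y ∂P.map (X s) (X (T ω) ω)) (hu.lintegral_kernel.comp hXT)] at h2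
    simp_rw [Pi.mul_apply, Kernel.map_apply _ (hX.measurable s),
      lintegral_map hu (hX.measurable s)] at h2
    exact h2
  have heT : Measurable fun p : Ω × ℝ => ENNReal.ofReal (Real.exp (-(r * T p.1))) :=
    he.comp (hT.comp measurable_fst)
  have het : Measurable fun p : Ω × ℝ => ENNReal.ofReal (Real.exp (-(r * p.2))) := by fun_prop
  have hm₁ : Measurable fun p : Ω × ℝ => ∫⁻ ω', u (X p.2.toNNReal ω') ∂(P (X (T p.1) p.1)) :=
    (hX.measurable_lintegral_transition hu).comp
      (measurable_snd.prodMk (hXT.comp measurable_fst))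
  have hm₂ : Measurable fun p : Ω × ℝ => u (X (T p.1 + p.2.toNNReal) p.1) :=
    hu.comp (hX.measurable_comp ((hT.comp measurable_fst).add measurable_snd.real_toNNReal)
      measurable_fst)
  simp_rw [discountedTail_eq_shift, hX.lintegral_greenMeasure' r _ hu]
  have hpull : ∀ ω, ENNReal.ofReal (Real.exp (-(r * T ω))) * ∫⁻ t in Ici (0 : ℝ),
      ENNReal.ofReal (Real.exp (-(r * t))) * ∫⁻ ω', u (X t.toNNReal ω') ∂(P (X (T ω) ω)) =
      ∫⁻ t in Ici (0 : ℝ), ENNReal.ofReal (Real.exp (-(r * T ω))) *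
        (ENNReal.ofReal (Real.exp (-(r * t))) *
          ∫⁻ ω', u (X t.toNNReal ω') ∂(P (X (T ω) ω))) := fun ω =>
    (lintegral_const_mul _ ((het.mul hm₁).comp measurable_prodMk_left)).symm
  simp_rw [hpull]
  refine (lintegral_lintegral_swap ?_).trans (Eq.trans ?_ (lintegral_lintegral_swap ?_).symm)
  · exact (heT.mul (het.mul hm₁)).aemeasurable
  swap
  · exact (heT.mul (het.mul hm₂)).aemeasurable
  refine lintegral_congr fun t => ?_
  simp_rw [mul_left_comm _ (ENNReal.ofReal (Real.exp (-(r * t))))]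
  refine (lintegral_const_mul _ ?_).trans (Eq.trans ?_ (lintegral_const_mul _ ?_).symm)
  · exact (heT.mul hm₁).comp measurable_prodMk_right
  swap
  · exact (heT.mul hm₂).comp measurable_prodMk_right
  rw [hfun]

variable {τ : Ω → WithTop ℝ≥0}

/-- The strong Markov property for discounted potentials. -/
theorem IsDiffusion.lintegral_greenMeasure_stoppingTime (hX : IsDiffusion X P) (x : E)
    (hτ : IsStoppingTime (completedFiltration X P) τ) (r : ℝ) {u : E → ℝ≥0∞} (hu : Measurable u) :
    ∫⁻ ω in {ω | τ ω ≠ ⊤}, ENNReal.ofReal (Real.exp (-(r * ((τ ω).untopD 0 : ℝ≥0)))) *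
        ∫⁻ y, u y ∂(greenMeasure X P r (X ((τ ω).untopD 0) ω)) ∂(P x) =
      ∫⁻ ω in {ω | τ ω ≠ ⊤}, discountedTail X r u ω ((τ ω).untopD 0 : ℝ≥0) ∂(P x) := by
  have hTm := hX.aemeasurable_untopD x hτ
  have hN := hX.nullMeasurableSet_ne_top x hτ
  -- `τ` is only almost everywhere measurable. The Borel version `T` agrees with it almost surely on
  -- `{τ ≠ ⊤}`, to which `P x` is restricted.
  set T := hTm.mk with hTdef
  have hT : Measurable T := hTm.measurable_mk
  have hTe : ∀ᵐ ω ∂(P x).restrict {ω | τ ω ≠ ⊤}, (τ ω).untopD 0 = T ω :=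
    ae_restrict_of_ae hTm.ae_eq_mk
  have hTop : ∀ᵐ ω ∂(P x).restrict {ω | τ ω ≠ ⊤}, τ ω ≠ ⊤ := ae_restrict_mem₀ hN
  have key := hX.lintegral_greenMeasure_randomTime (μ := (P x).restrict {ω | τ ω ≠ ⊤}) hT ?_ r hu
  · rw [← lintegral_congr_ae, key]
    · refine lintegral_congr_ae ?_
      filter_upwards [hTe] with ω hω
      rw [hω]
    · filter_upwards [hTe] with ω hω
      rw [hω]
  intro s B hB a
  have hA : MeasurableSet[hτ.measurableSpace] {ω | τ ω ≤ a} := hτ.measurableSet_le' a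
  have h := hX.strong_markov τ hτ _ hA s B hB x
  have hTB : MeasurableSet ({ω | T ω ≤ a} ∩ {ω | X (T ω + s) ω ∈ B}) :=
    (hT measurableSet_Iic).inter (hX.measurable_comp (hT.add_const s) measurable_id hB)
  have hTa : ({ω | T ω ≤ a} : Set Ω) =ᵐ[(P x).restrict {ω | τ ω ≠ ⊤}] {ω | τ ω ≤ a} := by
    filter_upwards [hTe, hTop] with ω hω htop
    refine propext ?_
    change T ω ≤ a ↔ τ ω ≤ a
    rw [← hω]
    lift τ ω to ℝ≥0 using htop with t
    simp only [WithTop.untopD_coe, WithTop.coe_le_coe]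
  have hL : (P x).restrict {ω | τ ω ≠ ⊤} ({ω | T ω ≤ a} ∩ {ω | X (T ω + s) ω ∈ B}) =
      P x ({ω | τ ω ≤ a} ∩ {ω | τ ω ≠ ⊤ ∧ X ((τ ω).untopD 0 + s) ω ∈ B}) := by
    rw [Measure.restrict_apply hTB]
    refine measure_congr ?_
    filter_upwards [hTm.ae_eq_mk] with ω hω
    refine propext ?_
    change ((T ω ≤ a ∧ X (T ω + s) ω ∈ B) ∧ τ ω ≠ ⊤) ↔
      (τ ω ≤ a ∧ τ ω ≠ ⊤ ∧ X ((τ ω).untopD 0 + s) ω ∈ B)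
    rw [hTdef, ← hω]
    cases h : τ ω with
    | top => simp
    | coe t => simp only [WithTop.untopD_coe, WithTop.coe_le_coe, ne_eq, WithTop.coe_ne_top,
        not_false_eq_true, and_true, true_and]
  rw [hL, h, setLIntegral_congr hTa, Measure.restrict_restrict₀]
  · refine lintegral_congr_ae ?_
    filter_upwards [ae_restrict_of_ae hTm.ae_eq_mk] with ω hω
    rw [hω]
    rfl
  · exact (hX.nullMeasurableSet_le x hτ a).mono_ac Measure.restrict_le_self.absolutelyContinuous

end

/-! ### Position of a continuous path at a hitting time. -/

section
variable {Ω Z : Type*} {Y : ℝ≥0 → Ω → Z} {D : Set Z} {ω : Ω}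

theorem untopD_hittingAfter (h : hittingAfter Y D 0 ω ≠ ⊤) :
    {i | Y i ω ∈ D}.Nonempty ∧ (hittingAfter Y D 0 ω).untopD 0 = sInf {i | Y i ω ∈ D} := by
  rw [Ne, hittingAfter_eq_top_iff] at h
  push Not at h
  obtain ⟨j, hj, hjD⟩ := h
  refine ⟨⟨j, hjD⟩, ?_⟩
  rw [hittingAfter, if_pos ⟨j, hj, hjD⟩, WithTop.untopD_coe]
  simp

theorem mem_closure_of_hittingAfter_ne_top [TopologicalSpace Z] (hY : Continuous fun t => Y t ω)
    (h : hittingAfter Y D 0 ω ≠ ⊤) : Y ((hittingAfter Y D 0 ω).untopD 0) ω ∈ closure D := by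
  obtain ⟨hne, heq⟩ := untopD_hittingAfter h
  rw [heq]
  exact map_mem_closure (f := fun t => Y t ω) hY (csInf_mem_closure hne (OrderBot.bddBelow _)) fun i hi => hi

/-- A continuous path starting in the interior of `S` leaves it through the boundary. -/
theorem mem_frontier_of_hittingAfter_ne_top [TopologicalSpace Z] (hY : Continuous fun t => Y t ω)
    (h0 : Y 0 ω ∈ interior D) (h : hittingAfter Y (interior D)ᶜ 0 ω ≠ ⊤) :
    Y ((hittingAfter Y (interior D)ᶜ 0 ω).untopD 0) ω ∈ frontier D := by
  have hmem := mem_closure_of_hittingAfter_ne_top hY h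
  rw [isOpen_interior.isClosed_compl.closure_eq] at hmem
  refine ⟨?_, hmem⟩
  have hlt : ∀ s < (hittingAfter Y (interior D)ᶜ 0 ω).untopD 0, Y s ω ∈ interior D := by
    intro s hs
    by_contra hcon
    refine notMem_of_lt_hittingAfter (u := Y) (s := (interior D)ᶜ) (k := s) ?_ zero_le hcon
    cases hT : hittingAfter Y (interior D)ᶜ 0 ω with
    | top => exact absurd hT h
    | coe T =>
      rw [hT, WithTop.untopD_coe] at hs
      exact WithTop.coe_lt_coe.2 hs
  generalize (hittingAfter Y (interior D)ᶜ 0 ω).untopD 0 = T at *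
  -- The path is interior at time `0` but not at `T`. So `T` is a limit of earlier times, at which
  -- the path is still in `interior D`.
  have hT : T ≠ 0 := by
    rintro rfl
    exact hmem h0
  have hTc : T ∈ closure (Iio T) := by
    rw [closure_Iio' ⟨0, pos_iff_ne_zero.2 hT⟩]
    exact self_mem_Iic
  exact closure_mono interior_subset (map_mem_closure (f := fun t => Y t ω) hY hTc hlt)

end

/-! ### Excessive and harmonic behaviour of potentials. -/

section
variable {Ω E : Type*} [MetricSpace E] [MeasurableSpace E] [BorelSpace E]
  [mΩ : MeasurableSpace Ω] {X : ℝ≥0 → Ω → E} {P : Kernel E Ω}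

theorem IsDiffusion.measurable_discounted (hX : IsDiffusion X P) (r : ℝ) {u : E → ℝ≥0∞}
    (hu : Measurable u) (ω : Ω) :
    Measurable fun t : ℝ => ENNReal.ofReal (Real.exp (-(r * t))) * u (X t.toNNReal ω) := by
  have h1 : Measurable fun t : ℝ => X t.toNNReal ω :=
    (hX.continuous_paths ω).measurable.comp measurable_real_toNNReal
  exact Measurable.mul (by fun_prop) (hu.comp h1)

theorem IsDiffusion.tendsto_discountedTail (hX : IsDiffusion X P) (r : ℝ) {u : E → ℝ≥0∞}
    (hu : Measurable u) {ω : Ω} (hfin : discountedTail X r u ω 0 ≠ ∞) :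
    Tendsto (fun n : ℕ => discountedTail X r u ω n) atTop (𝓝 0) := by
  have hm := hX.measurable_discounted r hu ω
  set φ : ℝ → ℝ≥0∞ := fun t => ENNReal.ofReal (Real.exp (-(r * t))) * u (X t.toNNReal ω) with hφ
  have heq : ∀ n : ℕ, discountedTail X r u ω n = ∫⁻ t in Ici (0 : ℝ), (Ici (n : ℝ)).indicator φ t := by
    intro n
    rw [lintegral_indicator measurableSet_Ici, Measure.restrict_restrict measurableSet_Ici,
      inter_eq_left.2 (Ici_subset_Ici.2 n.cast_nonneg)]
    rfl
  simp_rw [heq]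
  rw [← lintegral_zero (μ := volume.restrict (Ici (0 : ℝ)))]
  refine tendsto_lintegral_of_dominated_convergence φ
    (fun n => hm.indicator measurableSet_Ici)
    (fun n => Eventually.of_forall fun t => indicator_le_self _ _ t) hfin
    (Eventually.of_forall fun t => ?_)
  obtain ⟨n, hn⟩ := exists_nat_gt t
  refine tendsto_const_nhds.congr' ?_
  filter_upwards [eventually_ge_atTop n] with k hk
  have : t ∉ Ici (k : ℝ) := fun h =>
    absurd (hn.trans_le (Nat.cast_le.2 hk)) (not_lt.2 (mem_Ici.1 h))
  rw [indicator_of_notMem this]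

variable [IsMarkovKernel P] {τ : Ω → WithTop ℝ≥0}

/-- Discounted potentials are excessive. -/
theorem IsDiffusion.lintegral_greenMeasure_stoppingTime_le (hX : IsDiffusion X P) (x : E)
    (hτ : IsStoppingTime (completedFiltration X P) τ) (r : ℝ) {u : E → ℝ≥0∞} (hu : Measurable u) :
    ∫⁻ ω in {ω | τ ω ≠ ⊤}, ENNReal.ofReal (Real.exp (-(r * ((τ ω).untopD 0 : ℝ≥0)))) *
        ∫⁻ y, u y ∂(greenMeasure X P r (X ((τ ω).untopD 0) ω)) ∂(P x) ≤
      ∫⁻ y, u y ∂(greenMeasure X P r x) := by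
  rw [hX.lintegral_greenMeasure_stoppingTime x hτ r hu, hX.lintegral_greenMeasure r x hu]
  exact (lintegral_mono fun ω => discountedTail_anti X r u ω (NNReal.coe_nonneg _)).trans
    (setLIntegral_le_lintegral _ _)

/-- A discounted potential is harmonic up to a stopping time before which its charge is not
visited. -/
theorem IsDiffusion.lintegral_greenMeasure_stoppingTime_eq (hX : IsDiffusion X P) (x : E)
    (hτ : IsStoppingTime (completedFiltration X P) τ) (r : ℝ) {u : E → ℝ≥0∞} (hu : Measurable u)
    (h0 : ∀ ω (s : ℝ≥0), s < τ ω → u (X s ω) = 0) :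
    ∫⁻ ω in {ω | τ ω ≠ ⊤}, ENNReal.ofReal (Real.exp (-(r * ((τ ω).untopD 0 : ℝ≥0)))) *
        ∫⁻ y, u y ∂(greenMeasure X P r (X ((τ ω).untopD 0) ω)) ∂(P x) =
      ∫⁻ y, u y ∂(greenMeasure X P r x) := by
  rw [hX.lintegral_greenMeasure_stoppingTime x hτ r hu, hX.lintegral_greenMeasure r x hu,
    ← lintegral_indicator₀ (hX.nullMeasurableSet_ne_top x hτ)]
  refine lintegral_congr fun ω => ?_
  by_cases htop : τ ω = ⊤
  -- On `{τ = ⊤}` the charge is never visited, so the whole integral along the path is zero as well.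
  · rw [indicator_of_notMem (by simpa using htop), discountedTail, eq_comm,
      setLIntegral_congr_fun measurableSet_Ici (g := 0) fun t _ => ?_]
    · simp
    · simp [h0 ω t.toNNReal (htop ▸ WithTop.coe_lt_top _)]
  · rw [indicator_of_mem htop, discountedTail, discountedTail, ← lintegral_indicator
      measurableSet_Ici, ← lintegral_indicator measurableSet_Ici]
    refine lintegral_congr fun t => ?_
    lift τ ω to ℝ≥0 using htop with T hT
    rw [WithTop.untopD_coe]
    by_cases ht : (T : ℝ) ≤ t
    · rw [indicator_of_mem (mem_Ici.2 ht), indicator_of_mem (mem_Ici.2 (T.coe_nonneg.trans ht))]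
    · rw [indicator_of_notMem (s := Ici (T : ℝ)) ht]
      have hlt : ((t.toNNReal : ℝ≥0) : WithTop ℝ≥0) < τ ω ∨ t < 0 := by
        rcases lt_or_ge t 0 with h | h
        · exact Or.inr h
        · left
          rw [← hT, WithTop.coe_lt_coe, ← NNReal.coe_lt_coe, Real.coe_toNNReal t h]
          exact not_le.1 ht
      rcases hlt with h | h
      · simp only [indicator, h0 ω _ h, mul_zero, ite_self]
      · rw [indicator_of_notMem (s := Ici (0 : ℝ)) (fun h' => absurd h (not_lt.2 (mem_Ici.1 h')))]

end

/-! ### Rewards, the limit at infinity, and verification. -/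

section
variable {Ω E : Type*} [TopologicalSpace E] [MeasurableSpace E] [mΩ : MeasurableSpace Ω]
  {X : ℝ≥0 → Ω → E} {P : Kernel E Ω}

/-- With no reward at infinity, expected rewards take the form of the integrals over `{τ ≠ ⊤}` in
the potential identities. -/
theorem IsDiffusion.expectedReward_eq (hX : IsDiffusion X P) {r : ℝ} {g : E → ℝ} {x : E}
    (h : ∀ᵐ ω ∂(P x),
      limsup (fun s : ℝ≥0 => ENNReal.ofReal (Real.exp (-(r * s)) * g (X s ω))) atTop = 0)
    {τ : Ω → WithTop ℝ≥0} (hτ : IsStoppingTime (completedFiltration X P) τ) :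
    expectedReward X P r g τ x =
      ∫⁻ ω in {ω | τ ω ≠ ⊤}, ENNReal.ofReal (Real.exp (-(r * ((τ ω).untopD 0 : ℝ≥0)))) *
        ENNReal.ofReal (g (X ((τ ω).untopD 0) ω)) ∂(P x) := by
  rw [expectedReward, ← lintegral_indicator₀ (hX.nullMeasurableSet_ne_top x hτ)]
  refine lintegral_congr_ae ?_
  filter_upwards [h] with ω hω
  by_cases htop : τ ω = ⊤
  · rw [indicator_of_notMem (by simpa using htop), htop]
    exact hω
  · rw [indicator_of_mem htop]
    lift τ ω to ℝ≥0 using htop with T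
    rw [WithTop.untopD_coe, ← ENNReal.ofReal_mul (Real.exp_nonneg _)]
    rfl

end

section
variable {Ω E : Type*} [MetricSpace E] [ProperSpace E] [MeasurableSpace E] [BorelSpace E]
  [mΩ : MeasurableSpace Ω] {X : ℝ≥0 → Ω → E} {P : Kernel E Ω} [IsMarkovKernel P]

/-- The hitting time of a Borel set by a diffusion is a stopping time. -/
theorem IsDiffusion.isStoppingTime_hittingAfter (hX : IsDiffusion X P) {S : Set E}
    (hS : MeasurableSet S) : IsStoppingTime (completedFiltration X P) (hittingAfter X S 0) :=
  hX.isStoppingTime_hittingAfter_graph (measurable_snd hS)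

/-- If the boundary of `S` does not see the charge `w` outside `S`, neither does the interior. -/
theorem IsDiffusion.integral_greenMeasure_eq_zero_of_frontier (hX : IsDiffusion X P) (r : ℝ)
    {S : Set E} {w : E → ℝ} (hw : Measurable w) (hwS : ∀ y ∈ S, w y = 0)
    (hint : ∀ x, Integrable w (greenMeasure X P r x))
    (hfr : ∀ x ∈ frontier S, ∫ y, w y ∂(greenMeasure X P r x) = 0) {x : E}
    (hx : x ∈ interior S) : ∫ y, w y ∂(greenMeasure X P r x) = 0 := by
  -- The potential identities concern nonnegative charges, so the signed `w` is handled as equality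
  -- of the finite potentials of its two parts.
  have hiff : ∀ x, ∫ y, w y ∂(greenMeasure X P r x) = 0 ↔
      ∫⁻ y, ENNReal.ofReal (w y) ∂(greenMeasure X P r x) =
        ∫⁻ y, ENNReal.ofReal (-w y) ∂(greenMeasure X P r x) := by
    intro x
    have h1 : ∫⁻ y, ENNReal.ofReal (w y) ∂(greenMeasure X P r x) ≠ ∞ := (hint x).lintegral_lt_top.ne
    have h2 : ∫⁻ y, ENNReal.ofReal (-w y) ∂(greenMeasure X P r x) ≠ ∞ :=
      (hint x).neg.lintegral_lt_top.ne
    rw [integral_eq_lintegral_pos_part_sub_lintegral_neg_part (hint x), sub_eq_zero,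
      ENNReal.toReal_eq_toReal_iff' h1 h2]
  have hτ := hX.isStoppingTime_hittingAfter (S := (interior S)ᶜ) isOpen_interior.measurableSet.compl
  have hvan : ∀ ω (s : ℝ≥0), s < hittingAfter X (interior S)ᶜ 0 ω → w (X s ω) = 0 := by
    intro ω s hs
    have := notMem_of_lt_hittingAfter hs zero_le
    exact hwS _ (interior_subset (not_not.1 this))
  rw [hiff, ← hX.lintegral_greenMeasure_stoppingTime_eq x hτ r hw.ennreal_ofReal
      (fun ω s hs => by simp [hvan ω s hs]),
    ← hX.lintegral_greenMeasure_stoppingTime_eq x hτ r (u := fun y => ENNReal.ofReal (-w y))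
      hw.neg.ennreal_ofReal (fun ω s hs => by simp [hvan ω s hs])]
  refine lintegral_congr_ae ?_
  filter_upwards [ae_restrict_of_ae (hX.initial x),
    ae_restrict_mem₀ (hX.nullMeasurableSet_ne_top x hτ)] with ω h0 htop
  rw [(hiff _).1 (hfr _ (mem_frontier_of_hittingAfter_ne_top (hX.continuous_paths ω)
    (h0 ▸ hx) htop))]

/-- The discounted reward at infinity vanishes when `g` is dominated by a finite potential. -/
theorem IsDiffusion.ae_limsup_eq_zero (hX : IsDiffusion X P) {r : ℝ} {g : E → ℝ}
    (hg : Continuous g) {u : E → ℝ≥0∞} (hu : Measurable u)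
    (hgu : ∀ x, ENNReal.ofReal (g x) ≤ ∫⁻ y, u y ∂(greenMeasure X P r x)) (x : E)
    (hfin : ∫⁻ y, u y ∂(greenMeasure X P r x) ≠ ∞) :
    ∀ᵐ ω ∂(P x), limsup (fun s : ℝ≥0 => ENNReal.ofReal (Real.exp (-(r * s)) * g (X s ω))) atTop
      = 0 := by
  have hTm := fun a => hX.measurable_discountedTail r hu a
  rw [hX.lintegral_greenMeasure r x hu] at hfin
  have hlim : Tendsto (fun n : ℕ => ∫⁻ ω, discountedTail X r u ω n ∂(P x)) atTop (𝓝 0) := by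
    rw [← lintegral_zero (μ := P x)]
    refine tendsto_lintegral_of_dominated_convergence (fun ω => discountedTail X r u ω 0)
      (fun n => hTm n) (fun n => Eventually.of_forall fun ω =>
        discountedTail_anti X r u ω n.cast_nonneg) hfin ?_
    filter_upwards [ae_lt_top (hTm 0) hfin] with ω hω
    exact hX.tendsto_discountedTail r hu hω.ne
  have key : ∀ k : ℕ, ∀ᵐ ω ∂(P x), limsup (fun s : ℝ≥0 =>
      ENNReal.ofReal (Real.exp (-(r * s)) * g (X s ω))) atTop ≤ ENNReal.ofReal (1 / ((k : ℝ) + 1)) := by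
    intro k
    set c : ℝ := 1 / ((k : ℝ) + 1)
    have hc : 0 < c := by positivity
    -- Waiting until time `n` and the discount both involve time, hence the graph of `X`. `D n` is
    -- closed since `g` is continuous, so the graph lies in it at the hitting time.
    let D : ℕ → Set (ℝ≥0 × E) := fun n => {p | (n : ℝ≥0) ≤ p.1 ∧ c ≤ Real.exp (-(r * p.1)) * g p.2}
    have hD : ∀ n, IsClosed (D n) := fun n =>
      (isClosed_le continuous_const continuous_fst).inter
        (isClosed_le continuous_const
          ((by fun_prop : Continuous fun p : ℝ≥0 × E => Real.exp (-(r * p.1))).mul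
            (hg.comp continuous_snd)))
    let τ : ℕ → Ω → WithTop ℝ≥0 := fun n => hittingAfter (fun s ω => (s, X s ω)) (D n) 0
    have hτ : ∀ n, IsStoppingTime (completedFiltration X P) (τ n) := fun n =>
      hX.isStoppingTime_hittingAfter_graph (hD n).measurableSet
    -- Maximal inequality: at `τ n` the discounted potential is at least `c`, and its expectation is
    -- that of the tail after `τ n ≥ n`.
    have hbound : ∀ n, ENNReal.ofReal c * P x {ω | τ n ω ≠ ⊤} ≤
        ∫⁻ ω, discountedTail X r u ω n ∂(P x) := by
      intro n
      have hmem : ∀ ω, τ n ω ≠ ⊤ → ((τ n ω).untopD 0, X ((τ n ω).untopD 0) ω) ∈ D n := by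
        intro ω hω
        have := mem_closure_of_hittingAfter_ne_top
          (Y := fun (s : ℝ≥0) (ω : Ω) => (s, X s ω)) (D := D n)
          (continuous_id.prodMk (hX.continuous_paths ω)) hω
        rwa [(hD n).closure_eq] at this
      have hN := hX.nullMeasurableSet_ne_top x (hτ n)
      calc ENNReal.ofReal c * P x {ω | τ n ω ≠ ⊤}
          = ∫⁻ ω in {ω | τ n ω ≠ ⊤}, ENNReal.ofReal c ∂(P x) := by
            rw [setLIntegral_const]
        _ ≤ ∫⁻ ω in {ω | τ n ω ≠ ⊤},
              ENNReal.ofReal (Real.exp (-(r * ((τ n ω).untopD 0 : ℝ≥0)))) *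
              ∫⁻ y, u y ∂(greenMeasure X P r (X ((τ n ω).untopD 0) ω)) ∂(P x) := by
            refine lintegral_mono_ae ?_
            filter_upwards [ae_restrict_mem₀ hN] with ω hω
            refine (ENNReal.ofReal_le_ofReal (hmem ω hω).2).trans ?_
            rw [ENNReal.ofReal_mul (Real.exp_nonneg _)]
            gcongr
            exact hgu _
        _ = ∫⁻ ω in {ω | τ n ω ≠ ⊤}, discountedTail X r u ω ((τ n ω).untopD 0 : ℝ≥0) ∂(P x) :=
            hX.lintegral_greenMeasure_stoppingTime x (hτ n) r hu
        _ ≤ ∫⁻ ω in {ω | τ n ω ≠ ⊤}, discountedTail X r u ω n ∂(P x) := by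
            refine lintegral_mono_ae ?_
            filter_upwards [ae_restrict_mem₀ hN] with ω hω
            exact discountedTail_anti X r u ω (by exact_mod_cast (hmem ω hω).1)
        _ ≤ _ := setLIntegral_le_lintegral _ _
    have hnull : P x {ω | ∀ n, τ n ω ≠ ⊤} = 0 := by
      have h1 : ENNReal.ofReal c * P x {ω | ∀ n, τ n ω ≠ ⊤} ≤ 0 :=
        ge_of_tendsto' hlim fun n => (mul_le_mul_right (measure_mono fun ω (hω : ∀ n, τ n ω ≠ ⊤) => hω n) _).trans
          (hbound n)
      rcases mul_eq_zero.1 (le_zero_iff.1 h1) with h | h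
      · exact absurd hc (not_lt.2 (ENNReal.ofReal_eq_zero.1 h))
      · exact h
    -- If `τ n = ⊤`, the discounted reward stays below `c` after time `n`.
    have hae : ∀ᵐ ω ∂(P x), ∃ n, τ n ω = ⊤ := by
      rw [ae_iff]
      simpa using hnull
    filter_upwards [hae] with ω ⟨n, hn⟩
    refine limsup_le_of_le (by isBoundedDefault) ?_
    filter_upwards [eventually_ge_atTop (n : ℝ≥0)] with s hs
    refine ENNReal.ofReal_le_ofReal (le_of_not_ge fun hcon => ?_)
    exact hittingAfter_eq_top_iff.1 hn s zero_le ⟨hs, hcon⟩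
  filter_upwards [ae_all_iff.2 key] with ω hω
  have h0 := ENNReal.tendsto_ofReal (tendsto_one_div_add_atTop_nhds_zero_nat (𝕜 := ℝ))
  rw [ENNReal.ofReal_zero] at h0
  exact le_antisymm (ge_of_tendsto' h0 hω) zero_le

/-- Verification: a finite potential dominating `g`, equal to it on `closure S`, and with charge
carried by `S`, is the value function, and the hitting time of `S` is optimal. -/
theorem IsDiffusion.isOptimal_hitTime (hX : IsDiffusion X P) {r : ℝ} {g : E → ℝ}
    (hg : Continuous g) {S : Set E} (hS : MeasurableSet S) {u : E → ℝ≥0∞} (hu : Measurable u)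
    (huS : ∀ y ∉ S, u y = 0) (hfin : ∀ x, ∫⁻ y, u y ∂(greenMeasure X P r x) ≠ ∞)
    (hgu : ∀ x, ENNReal.ofReal (g x) ≤ ∫⁻ y, u y ∂(greenMeasure X P r x))
    (hgS : ∀ x ∈ closure S, ENNReal.ofReal (g x) = ∫⁻ y, u y ∂(greenMeasure X P r x)) :
    IsOptimal X P r g (hitTime X S) ∧
      ∀ x, valueFunction X P r g x = ∫⁻ y, u y ∂(greenMeasure X P r x) := by
  have hτ : IsStoppingTime (completedFiltration X P) (hitTime X S) :=
    hX.isStoppingTime_hittingAfter hS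
  have hlim := fun x => hX.ae_limsup_eq_zero hg hu hgu x (hfin x)
  have hhit : ∀ x, expectedReward X P r g (hitTime X S) x =
      ∫⁻ y, u y ∂(greenMeasure X P r x) := by
    intro x
    rw [hX.expectedReward_eq (hlim x) hτ, ← hX.lintegral_greenMeasure_stoppingTime_eq x hτ r hu
      fun ω s hs => huS _ (notMem_of_lt_hittingAfter hs zero_le)]
    refine lintegral_congr_ae ?_
    filter_upwards [ae_restrict_mem₀ (hX.nullMeasurableSet_ne_top x hτ)] with ω hω
    have hmem : X ((hitTime X S ω).untopD 0) ω ∈ closure S :=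
      mem_closure_of_hittingAfter_ne_top (hX.continuous_paths ω) hω
    rw [hgS _ hmem]
  have hval : ∀ x, valueFunction X P r g x = ∫⁻ y, u y ∂(greenMeasure X P r x) := by
    intro x
    refine le_antisymm (iSup₂_le fun τ hτ' => ?_) ?_
    · rw [hX.expectedReward_eq (hlim x) hτ']
      refine le_trans (lintegral_mono fun ω => ?_)
        (hX.lintegral_greenMeasure_stoppingTime_le x hτ' r hu)
      gcongr
      exact hgu _
    · rw [← hhit x]
      exact le_iSup₂_of_le (hitTime X S) hτ le_rfl
  exact ⟨⟨hτ, fun x => by rw [hhit, hval]⟩, hval⟩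

end

end GreenStopping

/-- Everything reduces to `isOptimal_hitTime` with `u = f 1_S`. Since `f ≥ 0` on `S`, passing to
`ENNReal.ofReal` loses nothing. -/
theorem theorem2p3 {d : ℕ} {Ω : Type*} [MeasurableSpace Ω]
    (X : ℝ≥0 → Ω → EuclideanSpace ℝ (Fin d))
    (P : Kernel (EuclideanSpace ℝ (Fin d)) Ω) [IsMarkovKernel P]
    (hX : GreenStopping.IsDiffusion X P)
    (r : ℝ) (hr : 0 < r)
    (g : EuclideanSpace ℝ (Fin d) → ℝ) (hg_cont : Continuous g) (hg_nonneg : ∀ x, 0 ≤ g x)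
    (f : EuclideanSpace ℝ (Fin d) → ℝ) (hf_meas : Measurable f)
    (hf_int : ∀ x, Integrable f (GreenStopping.greenMeasure X P r x))
    (hgf : ∀ x, g x = ∫ y, f y ∂(GreenStopping.greenMeasure X P r x))
    (S : Set (EuclideanSpace ℝ (Fin d))) (hS : MeasurableSet S)
    (hfS : ∀ x ∈ S, 0 ≤ f x)
    (V' : EuclideanSpace ℝ (Fin d) → ℝ)
    (hV' : ∀ x, V' x = ∫ y in S, f y ∂(GreenStopping.greenMeasure X P r x))
    (hV'_ge : ∀ x ∈ Sᶜ, g x ≤ V' x) :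
    ((∀ x ∈ frontier S, V' x = g x) ↔
      ∀ x ∈ frontier S, ∫ y in Sᶜ, f y ∂(GreenStopping.greenMeasure X P r x) = 0) ∧
    ((∀ x ∈ frontier S, V' x = g x) →
      GreenStopping.IsOptimal X P r g (GreenStopping.hitTime X S) ∧
      ∀ x, 0 ≤ V' x ∧ GreenStopping.valueFunction X P r g x = ENNReal.ofReal (V' x)) := by
  -- `g - Ṽ` is the potential of `f 1_{Sᶜ}`, which makes the two forms of (b) equivalent.
  have hsplit : ∀ x, V' x + ∫ y in Sᶜ, f y ∂(GreenStopping.greenMeasure X P r x) = g x := fun x => by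
    rw [hV', hgf, integral_add_compl hS (hf_int x)]
  have hiff : ∀ x, V' x = g x ↔ ∫ y in Sᶜ, f y ∂(GreenStopping.greenMeasure X P r x) = 0 :=
    fun x => by
      have := hsplit x
      constructor <;> intro h <;> linarith
  refine ⟨forall₂_congr fun x _ => hiff x, fun hb => ?_⟩
  have hind0 : ∀ y, 0 ≤ S.indicator f y := indicator_nonneg hfS
  have hV0 : ∀ x, 0 ≤ V' x := fun x => by
    rw [hV', ← integral_indicator hS]
    exact integral_nonneg hind0
  have hVu : ∀ x, ENNReal.ofReal (V' x) =
      ∫⁻ y, ENNReal.ofReal (S.indicator f y) ∂(GreenStopping.greenMeasure X P r x) := fun x => by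
    rw [hV', ← integral_indicator hS]
    exact ofReal_integral_eq_lintegral_ofReal ((hf_int x).indicator hS)
      (Eventually.of_forall hind0)
  -- Condition (b) is propagated from the boundary into the interior by stopping at the exit from
  -- `interior S`.
  have hinterior : ∀ x ∈ interior S, V' x = g x := fun x hx => by
    rw [hiff, ← integral_indicator hS.compl]
    refine hX.integral_greenMeasure_eq_zero_of_frontier r (hf_meas.indicator hS.compl)
      (fun y hy => indicator_of_notMem (not_not.2 hy) f)
      (fun x => (hf_int x).indicator hS.compl) (fun y hy => ?_) hx
    rw [integral_indicator hS.compl]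
    exact (hiff y).1 (hb y hy)
  have hclosure : ∀ x ∈ closure S, V' x = g x := fun x hx => by
    rw [closure_eq_interior_union_frontier] at hx
    exact hx.elim (hinterior x) (hb x)
  have hge : ∀ x, g x ≤ V' x := fun x => by
    by_cases hx : x ∈ S
    exacts [(hclosure x (subset_closure hx)).ge, hV'_ge x hx]
  have := hX.isOptimal_hitTime (r := r) hg_cont hS
    (u := fun y => ENNReal.ofReal (S.indicator f y)) (hf_meas.indicator hS).ennreal_ofReal
    (fun y hy => by simp [hy]) (fun x => hVu x ▸ ENNReal.ofReal_ne_top)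
    (fun x => hVu x ▸ ENNReal.ofReal_le_ofReal (hge x))
    (fun x hx => by rw [← hVu, hclosure x hx])
  exact ⟨this.1, fun x => ⟨hV0 x, by rw [this.2, hVu]⟩⟩
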